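/- Let $L$ be an even non-negative integer. On $\mathcal{H}=(\mathbb{C}^2)^{\otimes L}$, let $S^{(1)}_\alpha,S^{(2)}_\alpha,S^{(3)}_\alpha$ be the spin-$\tfrac12$ matrices (one half of the Pauli matrices) acting on the $\alpha$-th tensor factor, $1\le\alpha\le L$, and let $S^-_\alpha=S^{(1)}_\alpha-iS^{(2)}_\alpha$. Let $$H=\sum_{\alpha=1}^{L}\Big(\tfrac14\mathbb{1}-\sum_{\nu=1}^{3}S^{(\nu)}_\alpha S^{(\nu)}_{[\alpha+1]}\Big),\qquad [\alpha+1]=\alpha+1\text{ for }\alpha<L,\quad [L+1]=1,$$ be the Hamiltonian of the ferromagnetic Heisenberg ring. Let $\mathcal{H}(0)=\{\psi\in\mathcal{H}:\mathcal{C}\psi=0\}$, where $\mathcal{C}=\sum_{\nu=1}^{3}\big(\sum_{\alpha=1}^{L}S^{(\nu)}_\alpha\big)^2$, be the sector of total spin $0$, and let $$E_{\min}(0;L)=\min\Big\{\frac{\langle\psi,H\psi\rangle}{\|\psi\|^2}:\ \psi\in\mathcal{H}(0),\ \psi\ne0\Big\}.$$ Let $\mathcal{M}_L$ be the set of non-crossing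 perfect matchings of $\{1,\dots,L\}$, written as families of pairs $(\alpha_k,\beta_k)$, $1\le k\le L/2$, with $\alpha_1<\dots<\alpha_{L/2}$, $\alpha_k<\beta_k$, $\{\alpha_1,\dots,\alpha_{L/2},\beta_1,\dots,\beta_{L/2}\}=\{1,\dots,L\}$ and, for $j\ne k$, $\alpha_k<\alpha_j<\beta_k$ if and only if $\alpha_k<\beta_j<\beta_k$. For such a matching put $$\Phi_L(\boldsymbol\alpha,\boldsymbol\beta)=\prod_{k=1}^{L/2}\Big(\tfrac{1}{\sqrt2}S^-_{\alpha_k}-\tfrac1{\sqrt2}S^-_{\beta_k}\Big)\,\big(\Psi_{1/2,1/2}\otimes\cdots\otimes\Psi_{1/2,1/2}\big),$$ where $\Psi_{1/2,1/2}=\binom10$ is the spin-up vector. Then the minimum defining $E_{\min}(0;L)$ is attained, the vectors $\Phi_L(\boldsymbol\alpha,\boldsymbol\beta)$, $(\boldsymbol\alpha,\boldsymbol\beta)\in\mathcal{M}_L$, form a basis of $\mathcal{H}(0)$ (the Temperley--Lieb or Hulthén bracket basis), and there is a vector $\Theta_L\in\mathcal{H}(0)$, all of whose coordinates in this basis are real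 and strictly positive, such that $$H\,\Theta_L=E_{\min}(0;L)\,\Theta_L .$$ Moreover, this eigenvalue is non-degenerate in the spin-$0$ sector: $$\{\psi\in\mathcal{H}(0):\ H\psi=E_{\min}(0;L)\,\psi\}=\operatorname{span}(\Theta_L).$$ -/

import Mathlib

namespace SpinRing

/-- Spin configurations on the sites `0, …, L - 1`; the value `0` is spin up (`Ψ_{1/2,1/2}`)
and the value `1` is spin down (`Ψ_{1/2,-1/2}`). -/
abbrev Config (L : ℕ) : Type := Fin L → Fin 2

/-- The Hilbert space `(ℂ²)^{⊗ L}`, in coordinates with respect to the orthonormal product basis: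
the configuration `σ` labels the basis vector `Ψ_{σ 0} ⊗ ⋯ ⊗ Ψ_{σ (L-1)}`. -/
abbrev Space (L : ℕ) : Type := EuclideanSpace ℂ (Config L)

/-- Operators on `(ℂ²)^{⊗ L}`, as matrices in the product basis. -/
abbrev Op (L : ℕ) : Type := Matrix (Config L) (Config L) ℂ

/-- The action of an operator on the Hilbert space. -/
noncomputable abbrev act {L : ℕ} (A : Op L) : Space L →ₗ[ℂ] Space L := Matrix.toEuclideanLin A

/-- The tensor product `A₀ ⊗ ⋯ ⊗ A_{L-1}` of single-site matrices. -/
def tensor {L : ℕ} (A : Fin L → Matrix (Fin 2) (Fin 2) ℂ) : Op L :=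
  Matrix.of fun σ τ => ∏ x, A x (σ x) (τ x)

/-- The localization `1 ⊗ ⋯ ⊗ 1 ⊗ A ⊗ 1 ⊗ ⋯ ⊗ 1` of a single-site matrix `A` at the site `x`. -/
def site {L : ℕ} (x : Fin L) (A : Matrix (Fin 2) (Fin 2) ℂ) : Op L :=
  tensor (Function.update (fun _ => 1) x A)

/-- The spin-1/2 matrices `S^{(1)}, S^{(2)}, S^{(3)}` (indexed by `0, 1, 2`). -/
noncomputable def spin : Fin 3 → Matrix (Fin 2) (Fin 2) ℂ :=
  ![!![0, 1 / 2; 1 / 2, 0],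
    !![0, -Complex.I / 2; Complex.I / 2, 0],
    !![1 / 2, 0; 0, -1 / 2]]

/-- The spin-lowering matrix `S⁻ = S^{(1)} - i S^{(2)}`. -/
def spinLower : Matrix (Fin 2) (Fin 2) ℂ := !![0, 0; 1, 0]

/-- The ferromagnetic interaction
`h_{x,y} = 1/4 - S_x^{(1)} S_y^{(1)} - S_x^{(2)} S_y^{(2)} - S_x^{(3)} S_y^{(3)}`. -/
noncomputable def interaction {L : ℕ} (x y : Fin L) : Op L :=
  (1 / 4 : ℂ) • (1 : Op L) - ∑ ν, site x (spin ν) * site y (spin ν)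

/-- The Hamiltonian of the ring: the sum of `h_{x,[x+1]}` over all sites `x`, where `[x+1]` is
the cyclic successor of `x`. -/
noncomputable def hamiltonian (L : ℕ) : Op L :=
  ∑ x : Fin L, interaction x (finRotate L x)

/-- The total spin operators `S_tot^{(ν)} = ∑ₓ S_x^{(ν)}`. -/
noncomputable def totalSpin (L : ℕ) (ν : Fin 3) : Op L :=
  ∑ x : Fin L, site x (spin ν)

/-- The Casimir operator of the total spin. -/
noncomputable def casimir (L : ℕ) : Op L :=
  ∑ ν, totalSpin L ν ^ 2

/-- The total spin `S` sector `{ψ : C_tot ψ = S (S + 1) ψ}`. -/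
noncomputable def sector (L S : ℕ) : Submodule ℂ (Space L) :=
  Module.End.eigenspace (act (casimir L)) ((S : ℂ) * ((S : ℂ) + 1))

/-- The values of the Rayleigh quotient `⟨ψ, H ψ⟩ / ‖ψ‖²` (real, because `H` is Hermitian)
over the nonzero vectors of the total spin `S` sector. -/
noncomputable def rayleighValues (L S : ℕ) : Set ℝ :=
  {E | ∃ ψ ∈ sector L S, ψ ≠ 0 ∧ E = (inner ℂ ψ (act (hamiltonian L) ψ)).re / ‖ψ‖ ^ 2}

/-- The lowest energy in the total spin `S` sector. -/
noncomputable def Emin (L S : ℕ) : ℝ := sInf (rayleighValues L S)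

/-- Non-crossing perfect matchings of the `L` sites (for even `L`), given by their left endpoints,
in increasing order, and the corresponding right endpoints. -/
structure Matching (L : ℕ) where
  /-- left endpoints -/
  left : Fin (L / 2) → Fin L
  /-- right endpoints -/
  right : Fin (L / 2) → Fin L
  left_strictMono : StrictMono left
  left_lt_right : ∀ k, left k < right k
  cover : Set.range left ∪ Set.range right = Set.univ
  noncrossing : ∀ j k, j ≠ k →
    ((left k < left j ∧ left j < right k) ↔ (left k < right j ∧ right j < right k))

/-- The vector with all spins up. -/
noncomputable def allUp (L : ℕ) : Space L := EuclideanSpace.single (fun _ => 0) 1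

/-- The Hulthén bracket vector of a matching: the product, over the matched pairs `(a, b)`, of the
operators `(S_a⁻ - S_b⁻) / √2`, applied to the all-up vector. -/
noncomputable def bracket {L : ℕ} (m : Matching L) : Space L :=
  act (List.ofFn fun k : Fin (L / 2) =>
    (1 / (Real.sqrt 2 : ℂ)) • site (m.left k) spinLower
      - (1 / (Real.sqrt 2 : ℂ)) • site (m.right k) spinLower).prod (allUp L)

end SpinRing

/-!
In coordinates, the bracket vector of a non-crossing matching is a product of singlets, one for
every arc, oriented from left to right. The interaction of two sites is the projection
`(1 - P) / 2` onto their singlet, where `P` exchanges the two spins (`act_interaction`). Applied to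
successive sites of the ring, it reproduces a bracket vector with an arc between them; otherwise it
reconnects the two arcs that end there and, by the Plücker relation for singlets, multiplies by
`-1/2`. The sign is always the same because the arcs do not cross (`sign_reconnect`), also for the
bond that closes the ring. So in the bracket basis the Hamiltonian is a real matrix with nonpositive
off-diagonal entries (`act_hamiltonian_bracket`), and the claim is a Perron–Frobenius theorem.

Basis. The bracket vectors are linearly independent, being triangular with respect to the sum of
the positions of the down spins (`weight_le_of_bracket_ne_zero`). Conversely, a vector of the
spin-zero sector that vanishes on the configurations given by the left ends of matchings is zero:
these configurations are the Dyck paths (`exists_matching`), and on every other configuration with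
half of the spins down a Garnir relation (`sum_superset_disjoint_eq_zero`) expresses the vector by
its values on configurations of lower weight. So the dimension is the number of matchings.

Ground state. The basis is not orthogonal, so the usual argument that takes absolute values in the
variational principle is not available. Instead, the normalized powers of `c - H`, with `c` large,
preserve nonnegative coordinates and converge to the projection onto the lowest eigenspace, which
yields a nonnegative ground state (`exists_nonneg_eigenvector`). Irreducibility makes it positive
and unique (`eigenvector_pos`, `eigenvector_unique`). It holds because every matching is reached from
every other one by reconnections (`eq_univ_of_reconnect_mem`), which follows from the relation
`e_y e_x e_y = e_y` for neighbouring sites.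
-/

namespace SpinRing

variable {L : ℕ}

/-! ### Single-site operators, the Hamiltonian and the spin-zero sector -/

lemma act_apply (A : Op L) (ψ : Space L) (σ : Config L) :
    act A ψ σ = ∑ τ, A σ τ * ψ τ := by
  simp [act, Matrix.toLpLin_apply, Matrix.mulVec, dotProduct]

lemma act_mul (A B : Op L) (ψ : Space L) : act (A * B) ψ = act A (act B ψ) := by
  ext σ
  simp [act, Matrix.toLpLin_apply]

lemma site_apply (x : Fin L) (A : Matrix (Fin 2) (Fin 2) ℂ) (σ τ : Config L) :
    site x A σ τ = if τ = Function.update σ x (τ x) then A (σ x) (τ x) else 0 := by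
  have h : site x A σ τ
      = A (σ x) (τ x) * ∏ z ∈ Finset.univ.erase x, if σ z = τ z then 1 else 0 := by
    rw [site, tensor, Matrix.of_apply, ← Finset.mul_prod_erase _ _ (Finset.mem_univ x)]
    congr 1
    · simp
    · refine Finset.prod_congr rfl fun z hz => ?_
      rw [Function.update_of_ne (Finset.ne_of_mem_erase hz), Matrix.one_apply]
  rw [h, Finset.prod_ite_zero, Finset.prod_const_one]
  have : (∀ z ∈ Finset.univ.erase x, σ z = τ z) ↔ τ = Function.update σ x (τ x) := by
    simp only [Finset.mem_erase, Finset.mem_univ, and_true, Function.eq_update_iff, true_and]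
    exact forall₂_congr fun z _ => eq_comm
  by_cases hτ : τ = Function.update σ x (τ x)
  · rw [if_pos hτ, if_pos (this.mpr hτ), mul_one]
  · rw [if_neg hτ, if_neg (mt this.mp hτ), mul_zero]

/-- A single-site operator only changes the spin at its site. -/
lemma act_site (x : Fin L) (A : Matrix (Fin 2) (Fin 2) ℂ) (ψ : Space L) (σ : Config L) :
    act (site x A) ψ σ = ∑ s, A (σ x) s * ψ (Function.update σ x s) := by
  have hinj : Function.Injective fun s => Function.update σ x s :=
    Function.update_injective σ x
  have himage : ∑ s, A (σ x) s * ψ (Function.update σ x s)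
      = ∑ τ ∈ Finset.univ.image fun s => Function.update σ x s, A (σ x) (τ x) * ψ τ := by
    rw [Finset.sum_image fun a _ b _ h => hinj h]
    simp
  rw [act_apply, himage]
  symm
  apply Finset.sum_subset_zero_on_sdiff (Finset.subset_univ _)
  · intro τ hτ
    rw [site_apply, if_neg, zero_mul]
    intro h
    simp only [Finset.mem_sdiff, Finset.mem_univ, Finset.mem_image, true_and] at hτ
    exact hτ ⟨_, h.symm⟩
  · intro τ hτ
    simp only [Finset.mem_image, Finset.mem_univ, true_and] at hτ
    obtain ⟨s, rfl⟩ := hτ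
    simp [site_apply]

/-- The interaction is `(1 - P) / 2`, where `P` exchanges the two spins: it is the projection
onto the singlet of the two sites. -/
lemma act_interaction {x y : Fin L} (hxy : x ≠ y) (ψ : Space L) (σ : Config L) :
    act (interaction x y) ψ σ = (ψ σ - ψ (σ ∘ Equiv.swap x y)) / 2 := by
  have hsw : σ ∘ Equiv.swap x y
      = Function.update (Function.update σ x (σ y)) y (σ x) := by
    funext z
    by_cases hy : z = y
    · subst hy; simp
    by_cases hx : z = x
    · subst hx; simp [hxy]
    · simp [hx, hy, Equiv.swap_apply_of_ne_of_ne hx hy]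
  have hid : σ = Function.update (Function.update σ x (σ x)) y (σ y) := by simp
  have h1 : act (interaction x y) ψ σ = (1 / 4 : ℂ) * ψ σ
      - ∑ ν, ∑ s, spin ν (σ x) s * ∑ t, spin ν (σ y) t *
        ψ (Function.update (Function.update σ x s) y t) := by
    rw [interaction, act, map_sub, map_smul, map_sum]
    simp only [LinearMap.sub_apply, LinearMap.smul_apply, LinearMap.sum_apply, act_mul,
      PiLp.sub_apply, PiLp.smul_apply, smul_eq_mul]
    congr 1
    · congr 1
      rw [act_apply]; simp [Matrix.one_apply]
    · rw [WithLp.ofLp_sum, Finset.sum_apply]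
      refine Finset.sum_congr rfl fun ν _ => ?_
      rw [act_site]
      refine Finset.sum_congr rfl fun s _ => ?_
      rw [act_site]
      simp [hxy.symm]
  rw [h1, hsw]
  conv_lhs => enter [1]; rw [hid]
  conv_rhs => enter [1, 1]; rw [hid]
  generalize σ x = a
  generalize σ y = b
  simp only [Fin.sum_univ_three, Fin.sum_univ_two]
  fin_cases a <;> fin_cases b <;> simp [spin] <;> ring_nf <;> simp <;> ring

lemma isHermitian_site (x : Fin L) {A : Matrix (Fin 2) (Fin 2) ℂ} (hA : A.IsHermitian) :
    (site x A).IsHermitian := by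
  ext σ τ
  rw [Matrix.conjTranspose_apply, site, tensor, Matrix.of_apply, Matrix.of_apply, star_prod]
  refine Finset.prod_congr rfl fun z _ => ?_
  by_cases h : z = x
  · subst h; simpa using hA.apply _ _
  · rw [Function.update_of_ne h]
    exact Matrix.isHermitian_one.apply (σ z) (τ z)

lemma isHermitian_spin (ν : Fin 3) : (spin ν).IsHermitian := by
  ext i j
  fin_cases ν <;> fin_cases i <;> fin_cases j <;> simp [spin]

lemma isHermitian_totalSpin (ν : Fin 3) : (totalSpin L ν).IsHermitian := by
  rw [totalSpin, Matrix.IsHermitian, Matrix.conjTranspose_sum]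
  exact Finset.sum_congr rfl fun x _ => isHermitian_site x (isHermitian_spin ν)

lemma isSymmetric_act {A : Op L} (hA : A.IsHermitian) : (act A).IsSymmetric :=
  Matrix.isSymmetric_toEuclideanLin_iff.mpr hA

/-- The spin-zero sector is the common kernel of the components of the total spin, since
`⟨ψ, C ψ⟩` is the sum of the `‖S^{(ν)} ψ‖²`. -/
lemma mem_sector_zero_iff (ψ : Space L) :
    ψ ∈ sector L 0 ↔ ∀ ν, act (totalSpin L ν) ψ = 0 := by
  have hC : act (casimir L) ψ = ∑ ν, act (totalSpin L ν) (act (totalSpin L ν) ψ) := by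
    rw [casimir, act, map_sum, LinearMap.sum_apply]
    exact Finset.sum_congr rfl fun ν _ => by rw [sq]; exact act_mul _ _ _
  rw [sector, Module.End.mem_eigenspace_iff]
  constructor
  · intro h
    have h0 : ∑ ν, ‖act (totalSpin L ν) ψ‖ ^ 2 = 0 := by
      have : inner ℂ ψ (act (casimir L) ψ) = 0 := by rw [h]; simp
      rw [hC, inner_sum] at this
      have h2 : ∀ ν, inner ℂ ψ (act (totalSpin L ν) (act (totalSpin L ν) ψ))
          = ((‖act (totalSpin L ν) ψ‖ ^ 2 : ℝ) : ℂ) := fun ν => by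
        rw [← isSymmetric_act (isHermitian_totalSpin ν), inner_self_eq_norm_sq_to_K]
        norm_cast
      simp only [h2] at this
      exact_mod_cast this
    intro ν
    rw [Finset.sum_eq_zero_iff_of_nonneg (fun _ _ => by positivity)] at h0
    simpa using h0 ν (Finset.mem_univ _)
  · intro h
    rw [hC]
    simp [h]

lemma act_totalSpin (ν : Fin 3) (ψ : Space L) (σ : Config L) :
    act (totalSpin L ν) ψ σ = ∑ x, ∑ s, spin ν (σ x) s * ψ (Function.update σ x s) := by
  rw [totalSpin, act, map_sum, LinearMap.sum_apply, WithLp.ofLp_sum, Finset.sum_apply]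
  exact Finset.sum_congr rfl fun x _ => act_site x _ ψ σ

lemma isSymmetric_hamiltonian : (act (hamiltonian L)).IsSymmetric := by
  apply isSymmetric_act
  rw [hamiltonian, Matrix.IsHermitian, Matrix.conjTranspose_sum]
  refine Finset.sum_congr rfl fun x _ => ?_
  have hcomm : ∀ (ν : Fin 3) (y : Fin L),
      site y (spin ν) * site x (spin ν) = site x (spin ν) * site y (spin ν) := by
    intro ν y
    rcases eq_or_ne x y with rfl | hxy
    · rfl
    apply Matrix.toEuclideanLin.injective
    ext ψ σ
    change act _ ψ σ = act _ ψ σ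
    simp only [act_mul, act_site, Finset.mul_sum, Function.update_of_ne hxy,
      Function.update_of_ne hxy.symm]
    rw [Finset.sum_comm]
    refine Finset.sum_congr rfl fun s _ => Finset.sum_congr rfl fun t _ => ?_
    rw [Function.update_comm hxy]
    ring
  rw [interaction, Matrix.conjTranspose_sub, Matrix.conjTranspose_smul, Matrix.conjTranspose_one,
    Matrix.conjTranspose_sum]
  congr 1
  · simp
  · refine Finset.sum_congr rfl fun ν _ => ?_
    rw [Matrix.conjTranspose_mul, isHermitian_site _ (isHermitian_spin ν),
      isHermitian_site _ (isHermitian_spin ν), hcomm]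

/-! ### Matchings as involutions, and the bracket vectors as products of singlets -/

/-- A non-crossing perfect matching, encoded as the fixed-point-free involution that exchanges
the two ends of every arc. -/
structure IsNonCrossing (τ : Fin L → Fin L) : Prop where
  invol : ∀ x, τ (τ x) = x
  ne : ∀ x, τ x ≠ x
  nest : ∀ c p, c < p → p < τ c → c < τ p ∧ τ p < τ c

namespace Matching

lemma ends_bijective (hL : Even L) (m : Matching L) :
    Function.Bijective (Sum.elim m.left m.right) := by
  rw [Fintype.bijective_iff_surjective_and_card]
  refine ⟨?_, ?_⟩
  · rw [← Set.range_eq_univ, Set.Sum.elim_range, m.cover]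
  · simp only [Fintype.card_sum, Fintype.card_fin]
    obtain ⟨n, rfl⟩ := hL
    omega

/-- The sites, listed as the left and the right ends of the arcs. -/
noncomputable def endsEquiv (hL : Even L) (m : Matching L) :
    Fin (L / 2) ⊕ Fin (L / 2) ≃ Fin L :=
  Equiv.ofBijective _ (m.ends_bijective hL)

@[simp] lemma endsEquiv_inl (hL : Even L) (m : Matching L) (k : Fin (L / 2)) :
    m.endsEquiv hL (.inl k) = m.left k := rfl

@[simp] lemma endsEquiv_inr (hL : Even L) (m : Matching L) (k : Fin (L / 2)) :
    m.endsEquiv hL (.inr k) = m.right k := rfl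

/-- The site at the other end of the arc. -/
noncomputable def partner (hL : Even L) (m : Matching L) (x : Fin L) : Fin L :=
  m.endsEquiv hL ((m.endsEquiv hL).symm x).swap

@[simp] lemma partner_left (hL : Even L) (m : Matching L) (k : Fin (L / 2)) :
    m.partner hL (m.left k) = m.right k := by
  rw [partner, ← m.endsEquiv_inl hL, Equiv.symm_apply_apply, Sum.swap_inl, endsEquiv_inr]

@[simp] lemma partner_right (hL : Even L) (m : Matching L) (k : Fin (L / 2)) :
    m.partner hL (m.right k) = m.left k := by
  rw [partner, ← m.endsEquiv_inr hL, Equiv.symm_apply_apply, Sum.swap_inr, endsEquiv_inl]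

lemma exists_end (hL : Even L) (m : Matching L) (x : Fin L) :
    (∃ k, x = m.left k) ∨ ∃ k, x = m.right k := by
  obtain ⟨k | k, rfl⟩ := (m.endsEquiv hL).surjective x
  · exact .inl ⟨k, rfl⟩
  · exact .inr ⟨k, rfl⟩

lemma isNonCrossing_partner (hL : Even L) (m : Matching L) : IsNonCrossing (m.partner hL) where
  invol x := by
    obtain ⟨k, rfl⟩ | ⟨k, rfl⟩ := m.exists_end hL x <;> simp
  ne x := by
    obtain ⟨k, rfl⟩ | ⟨k, rfl⟩ := m.exists_end hL x
    · simpa using (m.left_lt_right k).ne'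
    · simpa using (m.left_lt_right k).ne
  nest c p hcp hpc := by
    obtain ⟨k, rfl⟩ | ⟨k, rfl⟩ := m.exists_end hL c
    · rw [partner_left] at hpc ⊢
      obtain ⟨j, rfl⟩ | ⟨j, rfl⟩ := m.exists_end hL p
      · rw [partner_left]
        have hjk : j ≠ k := by rintro rfl; exact lt_irrefl _ hcp
        exact (m.noncrossing j k hjk).1 ⟨hcp, hpc⟩
      · rw [partner_right]
        have hjk : j ≠ k := by rintro rfl; exact lt_irrefl _ hpc
        exact (m.noncrossing j k hjk).2 ⟨hcp, hpc⟩
    · rw [partner_right] at hpc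
      exact absurd ((m.left_lt_right k).trans (hcp.trans hpc)) (lt_irrefl _)

lemma lt_partner_iff (hL : Even L) (m : Matching L) (x : Fin L) :
    x < m.partner hL x ↔ x ∈ Set.range m.left := by
  obtain ⟨k, rfl⟩ | ⟨k, rfl⟩ := m.exists_end hL x
  · simpa using m.left_lt_right k
  · rw [partner_right]
    refine ⟨fun h => absurd h (m.left_lt_right k).le.not_gt, ?_⟩
    rintro ⟨j, hj⟩
    have : (Sum.inl j : Fin (L / 2) ⊕ Fin (L / 2)) = Sum.inr k := (m.ends_bijective hL).1 hj
    simp at this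

lemma partner_injective (hL : Even L) : Function.Injective (partner (L := L) hL) := by
  intro m m' h
  have hl : m.left = m'.left := by
    rw [← StrictMono.range_inj m.left_strictMono m'.left_strictMono]
    ext x
    rw [← lt_partner_iff hL, ← lt_partner_iff hL, h]
  have hr : m.right = m'.right := by
    funext k
    rw [← partner_left hL, ← partner_left hL, h, hl]
  cases m; cases m'; simp_all

end Matching

lemma IsNonCrossing.card_left {τ : Fin L → Fin L} (h : IsNonCrossing τ) :
    (Finset.univ.filter fun x => x < τ x).card = L / 2 := by
  have h1 : (Finset.univ.filter fun x => x < τ x).card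
      = (Finset.univ.filter fun x => ¬ x < τ x).card := by
    refine Finset.card_bij (fun x _ => τ x) ?_ ?_ ?_
    · intro x hx
      simp only [Finset.mem_filter, Finset.mem_univ, true_and, h.invol, not_lt] at hx ⊢
      exact hx.le
    · intro x _ y _ hxy
      rw [← h.invol x, hxy, h.invol]
    · intro y hy
      simp only [Finset.mem_filter, Finset.mem_univ, true_and, not_lt] at hy
      exact ⟨τ y, by simpa [h.invol] using lt_of_le_of_ne hy (h.ne y), h.invol y⟩
  have h2 := Finset.card_filter_add_card_filter_not (s := (Finset.univ : Finset (Fin L)))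
    (fun x => x < τ x)
  rw [Finset.card_univ, Fintype.card_fin] at h2
  omega

/-- The matching with a given partner involution. -/
noncomputable def Matching.ofPartner (τ : Fin L → Fin L) (h : IsNonCrossing τ) : Matching L where
  left := (Finset.univ.filter fun x => x < τ x).orderEmbOfFin h.card_left
  right k := τ ((Finset.univ.filter fun x => x < τ x).orderEmbOfFin h.card_left k)
  left_strictMono := OrderEmbedding.strictMono _
  left_lt_right k := by
    have := Finset.orderEmbOfFin_mem (Finset.univ.filter fun x => x < τ x) h.card_left k
    exact (Finset.mem_filter.mp this).2
  cover := by
    refine Set.eq_univ_of_forall fun x => ?_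
    have hr : ∀ y, y < τ y →
        ∃ k, (Finset.univ.filter fun x => x < τ x).orderEmbOfFin h.card_left k = y := by
      intro y hy
      have : y ∈ Set.range ((Finset.univ.filter fun x => x < τ x).orderEmbOfFin h.card_left) := by
        rw [Finset.range_orderEmbOfFin]; simpa using hy
      exact this
    rcases lt_or_gt_of_ne (h.ne x).symm with hx | hx
    · exact .inl (hr x hx)
    · obtain ⟨k, hk⟩ := hr (τ x) (by rwa [h.invol])
      exact .inr ⟨k, by simp only [hk, h.invol]⟩
  noncrossing j k _ := by
    refine ⟨fun ⟨h1, h2⟩ => h.nest _ _ h1 h2, fun ⟨h1, h2⟩ => ?_⟩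
    have := h.nest _ _ h1 h2
    rwa [h.invol] at this

lemma Matching.partner_ofPartner (hL : Even L) (τ : Fin L → Fin L) (h : IsNonCrossing τ) :
    (Matching.ofPartner τ h).partner hL = τ := by
  funext x
  obtain ⟨k, rfl⟩ | ⟨k, rfl⟩ := (Matching.ofPartner τ h).exists_end hL x
  · rw [partner_left]; rfl
  · rw [partner_right]; exact (h.invol _).symm

instance : Finite (Matching L) :=
  Finite.of_injective (fun m => (m.left, m.right)) fun m m' h => by
    cases m; cases m'; simp_all

noncomputable instance : Fintype (Matching L) := Fintype.ofFinite _

/-- The antisymmetric spin function of a singlet: `1` for down-up and `-1` for up-down. -/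
def singlet : Matrix (Fin 2) (Fin 2) ℂ := !![0, -1; 1, 0]

/-- A product of the operators `c (S⁻_a - S⁻_b)` over disjoint pairs `(a, b)`, applied to the
all-up vector, is a product of singlets on these pairs and of up spins on the other sites. -/
lemma prod_lower_allUp (c : ℂ) (n : ℕ) (l r : Fin n → Fin L)
    (hinj : Function.Injective (Sum.elim l r)) (σ : Config L) :
    act (List.ofFn fun k => c • site (l k) spinLower - c • site (r k) spinLower).prod
        (allUp L) σ
      = (∏ k, c * singlet (σ (l k)) (σ (r k)))
        * if ∀ z, (∀ k, z ≠ l k ∧ z ≠ r k) → σ z = 0 then 1 else 0 := by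
  induction n generalizing σ with
  | zero =>
    have : (∀ z, (∀ k : Fin 0, z ≠ l k ∧ z ≠ r k) → σ z = 0) ↔ σ = fun _ => 0 := by
      simp [funext_iff]
    rw [if_congr this rfl rfl, act_apply]
    simp [allUp, Matrix.one_apply]
  | succ n ih =>
    have hinj' : Function.Injective
        (Sum.elim (fun k : Fin n => l k.succ) (fun k : Fin n => r k.succ)) := by
      have := hinj.comp (Sum.map_injective.mpr ⟨Fin.succ_injective n, Fin.succ_injective n⟩)
      rwa [Sum.elim_comp_map] at this
    have hll : ∀ k : Fin n, l k.succ ≠ l 0 := fun k h => by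
      have := hinj (a₁ := Sum.inl k.succ) (a₂ := Sum.inl 0) h
      simp at this
    have hrr : ∀ k : Fin n, r k.succ ≠ r 0 := fun k h => by
      have := hinj (a₁ := Sum.inr k.succ) (a₂ := Sum.inr 0) h
      simp at this
    have hlr : ∀ j k, l j ≠ r k := fun j k h => by
      have := hinj (a₁ := Sum.inl j) (a₂ := Sum.inr k) h
      simp at this
    rw [List.ofFn_succ, List.prod_cons, act_mul]
    set v := act (List.ofFn fun k : Fin n =>
      c • site (l k.succ) spinLower - c • site (r k.succ) spinLower).prod (allUp L) with hv
    have hstep : act (c • site (l 0) spinLower - c • site (r 0) spinLower) v σ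
        = c * (∑ s, spinLower (σ (l 0)) s * v (Function.update σ (l 0) s)
          - ∑ s, spinLower (σ (r 0)) s * v (Function.update σ (r 0) s)) := by
      rw [mul_sub, ← act_site, ← act_site]
      simp [act]
    have hvl : ∀ s, v (Function.update σ (l 0) s)
        = (∏ k : Fin n, c * singlet (σ (l k.succ)) (σ (r k.succ))) *
          if s = 0 ∧ σ (r 0) = 0 ∧ ∀ z, (∀ k, z ≠ l k ∧ z ≠ r k) → σ z = 0 then 1 else 0 := by
      intro s
      rw [hv, ih (fun k => l k.succ) (fun k => r k.succ) hinj']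
      congr 1
      · refine Finset.prod_congr rfl fun k _ => ?_
        rw [Function.update_of_ne (hll k), Function.update_of_ne (hlr _ _).symm]
      · refine if_congr ⟨fun h => ⟨?_, ?_, fun z hz => ?_⟩, fun ⟨h1, h2, h3⟩ z hz => ?_⟩ rfl rfl
        · simpa using h (l 0) fun k => ⟨(hll k).symm, hlr _ _⟩
        · have := h (r 0) fun k => ⟨(hlr _ _).symm, (hrr k).symm⟩
          rwa [Function.update_of_ne (hlr _ _).symm] at this
        · have := h z fun k => hz k.succ
          rwa [Function.update_of_ne (hz 0).1] at this
        · by_cases hzl : z = l 0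
          · rw [hzl, Function.update_self, h1]
          rw [Function.update_of_ne hzl]
          by_cases hzr : z = r 0
          · rw [hzr, h2]
          exact h3 z (Fin.cases ⟨hzl, hzr⟩ hz)
    have hvr : ∀ s, v (Function.update σ (r 0) s)
        = (∏ k : Fin n, c * singlet (σ (l k.succ)) (σ (r k.succ))) *
          if s = 0 ∧ σ (l 0) = 0 ∧ ∀ z, (∀ k, z ≠ l k ∧ z ≠ r k) → σ z = 0 then 1 else 0 := by
      intro s
      rw [hv, ih (fun k => l k.succ) (fun k => r k.succ) hinj']
      congr 1
      · refine Finset.prod_congr rfl fun k _ => ?_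
        rw [Function.update_of_ne (hrr k), Function.update_of_ne (hlr _ _)]
      · refine if_congr ⟨fun h => ⟨?_, ?_, fun z hz => ?_⟩, fun ⟨h1, h2, h3⟩ z hz => ?_⟩ rfl rfl
        · simpa using h (r 0) fun k => ⟨(hlr _ _).symm, (hrr k).symm⟩
        · have := h (l 0) fun k => ⟨(hll k).symm, hlr _ _⟩
          rwa [Function.update_of_ne (hlr _ _)] at this
        · have := h z fun k => hz k.succ
          rwa [Function.update_of_ne (hz 0).2] at this
        · by_cases hzr : z = r 0
          · rw [hzr, Function.update_self, h1]
          rw [Function.update_of_ne hzr]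
          by_cases hzl : z = l 0
          · rw [hzl, h2]
          exact h3 z (Fin.cases ⟨hzl, hzr⟩ hz)
    rw [hstep]
    simp only [hvl, hvr, Fin.prod_univ_succ]
    generalize σ (l 0) = a
    generalize σ (r 0) = b
    simp only [Fin.sum_univ_two]
    fin_cases a <;> fin_cases b <;> simp [spinLower, singlet]
    split_ifs <;> simp

/-- The factor of the site `x` in the bracket vector of the involution `τ`: every arc contributes
its singlet at its left end. -/
def arcFactor (τ : Fin L → Fin L) (σ : Config L) (x : Fin L) : ℂ :=
  if x < τ x then singlet (σ x) (σ (τ x)) else 1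

lemma bracket_apply_pairs (hL : Even L) (m : Matching L) (σ : Config L) :
    bracket m σ = (1 / (Real.sqrt 2 : ℂ)) ^ (L / 2)
      * ∏ k, singlet (σ (m.left k)) (σ (m.right k)) := by
  rw [bracket, prod_lower_allUp _ _ _ _ (m.ends_bijective hL).1, if_pos, mul_one,
    Finset.prod_mul_distrib]
  · simp
  · intro z hz
    obtain ⟨k, rfl⟩ | ⟨k, rfl⟩ := m.exists_end hL z
    · exact absurd rfl (hz k).1
    · exact absurd rfl (hz k).2

lemma bracket_apply (hL : Even L) (m : Matching L) (σ : Config L) :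
    bracket m σ = (1 / (Real.sqrt 2 : ℂ)) ^ (L / 2) * ∏ x, arcFactor (m.partner hL) σ x := by
  rw [bracket_apply_pairs hL, ← (m.endsEquiv hL).prod_comp, Fintype.prod_sum_type]
  simp [arcFactor, m.left_lt_right, (m.left_lt_right _).not_gt]

/-! ### The Temperley–Lieb action on the bracket vectors -/

lemma singlet_antisymm (s t : Fin 2) : singlet s t = -singlet t s := by
  fin_cases s <;> fin_cases t <;> simp [singlet]

/-- The Plücker relation, which reconnects two singlets. -/
lemma singlet_plucker (s t u v : Fin 2) :
    singlet s u * singlet t v - singlet t u * singlet s v = singlet s t * singlet u v := by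
  fin_cases s <;> fin_cases t <;> fin_cases u <;> fin_cases v <;> simp [singlet]

/-- The singlet on the sites `p` and `q`, oriented from left to right; symmetric in `p` and `q`. -/
def pairFactor (σ : Config L) (p q : Fin L) : ℂ :=
  (if p < q then 1 else -1) * singlet (σ p) (σ q)

lemma arcFactor_mul_arcFactor {τ : Fin L → Fin L} (h : IsNonCrossing τ) (σ : Config L)
    (x : Fin L) : arcFactor τ σ x * arcFactor τ σ (τ x) = pairFactor σ x (τ x) := by
  rcases lt_or_gt_of_ne (h.ne x).symm with hx | hx
  · simp [arcFactor, pairFactor, h.invol, hx, hx.not_gt]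
  · simp [arcFactor, pairFactor, h.invol, hx, hx.not_gt, singlet_antisymm (σ x)]

lemma prod_arcFactor_eq {τ : Fin L → Fin L} (h : IsNonCrossing τ) (σ : Config L) (x : Fin L) :
    ∏ z, arcFactor τ σ z = pairFactor σ x (τ x) * ∏ z ∈ {x, τ x}ᶜ, arcFactor τ σ z := by
  rw [← Finset.prod_mul_prod_compl {x, τ x}, Finset.prod_pair (h.ne x).symm,
    arcFactor_mul_arcFactor h]

lemma IsNonCrossing.eq_of_eq {τ : Fin L → Fin L} (h : IsNonCrossing τ) {x y : Fin L}
    (hxy : τ x = τ y) : x = y := by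
  rw [← h.invol x, hxy, h.invol]

lemma prod_arcFactor_eq_of_ne {τ : Fin L → Fin L} (h : IsNonCrossing τ) (σ : Config L)
    {x y : Fin L} (hxy : x ≠ y) (hτ : τ x ≠ y) :
    ∏ z, arcFactor τ σ z = pairFactor σ x (τ x) * pairFactor σ y (τ y)
      * ∏ z ∈ {x, τ x, y, τ y}ᶜ, arcFactor τ σ z := by
  have h1 : x ≠ τ y := fun h' => hτ (by rw [h', h.invol])
  have h2 : τ x ≠ τ y := fun h' => hxy (h.eq_of_eq h')
  rw [← Finset.prod_mul_prod_compl {x, τ x, y, τ y}, Finset.prod_insert, Finset.prod_insert,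
    Finset.prod_pair (h.ne y).symm, arcFactor_mul_arcFactor h, ← mul_assoc,
    arcFactor_mul_arcFactor h]
  · simp [hτ, h2]
  · simp [hxy, h1, (h.ne x).symm]

lemma arcFactor_congr {τ τ' : Fin L → Fin L} {σ σ' : Config L} {z : Fin L} (hτ : τ z = τ' z)
    (h1 : σ z = σ' z) (h2 : σ (τ z) = σ' (τ z)) : arcFactor τ σ z = arcFactor τ' σ' z := by
  simp only [arcFactor, ← hτ, h1, h2]

/-- Every arc is a singlet, and hence the total spin annihilates a bracket vector. -/
lemma bracket_mem_sector (hL : Even L) (m : Matching L) : bracket m ∈ sector L 0 := by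
  rw [mem_sector_zero_iff]
  intro ν
  have h := m.isNonCrossing_partner hL
  set τ := m.partner hL with hτ
  ext σ
  rw [act_totalSpin]
  set f : Fin L → ℂ :=
    fun x => ∑ s, spin ν (σ x) s * bracket m (Function.update σ x s) with hf
  have hpair : ∀ x, f x + f (τ x) = 0 := by
    intro x
    obtain ⟨R, h1⟩ : ∃ R : ℂ, ∀ (σ' : Config L), (∀ z, z ≠ x → z ≠ τ x → σ' z = σ z) →
        bracket m σ' = R * singlet (σ' x) (σ' (τ x)) := by
      refine ⟨(1 / (Real.sqrt 2 : ℂ)) ^ (L / 2) * ((if x < τ x then 1 else -1)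
          * (∏ z ∈ {x, τ x}ᶜ, arcFactor τ σ z)), fun σ' hσ' => ?_⟩
      have h2 : ∏ z ∈ {x, τ x}ᶜ, arcFactor τ σ' z = ∏ z ∈ {x, τ x}ᶜ, arcFactor τ σ z := by
        refine Finset.prod_congr rfl fun z hz => ?_
        simp only [Finset.mem_compl, Finset.mem_insert, Finset.mem_singleton, not_or] at hz
        refine arcFactor_congr rfl (hσ' z hz.1 hz.2) (hσ' _ ?_ ?_)
        · intro h'; exact hz.2 (by rw [← h', h.invol])
        · intro h'; exact hz.1 (h.eq_of_eq h')
      rw [bracket_apply hL, ← hτ, prod_arcFactor_eq h σ' x, h2, pairFactor]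
      ring
    have h3 : ∀ s, bracket m (Function.update σ x s) = _ := fun s =>
      h1 (Function.update σ x s) fun z hz _ => Function.update_of_ne hz _ _
    have h4 : ∀ s, bracket m (Function.update σ (τ x) s) = _ := fun s =>
      h1 (Function.update σ (τ x) s) fun z _ hz => Function.update_of_ne hz _ _
    simp only [hf, h3, h4, Function.update_self, Function.update_of_ne (h.ne x),
      Function.update_of_ne (h.ne x).symm]
    generalize σ x = a
    generalize σ (τ x) = b
    fin_cases ν <;> fin_cases a <;> fin_cases b <;> simp [spin, singlet] <;> ring
  have hsum : ∑ x, f x = ∑ x, f (τ x) :=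
    (Equiv.sum_comp (Function.Involutive.toPerm τ h.invol) f).symm
  have h2 : ∑ x, f x + ∑ x, f x = 0 := by
    nth_rw 2 [hsum]
    rw [← Finset.sum_add_distrib]
    exact Finset.sum_eq_zero fun x _ => hpair x
  simpa using h2

/-- The site `y` is the cyclic successor of `x`. -/
def Successive (x y : Fin L) : Prop :=
  (x : ℕ) + 1 = y ∨ ((x : ℕ) + 1 = L ∧ (y : ℕ) = 0)

lemma successive_finRotate (x : Fin L) : Successive x (finRotate L x) := by
  obtain _ | n := L
  · exact x.elim0
  rcases eq_or_ne x (Fin.last n) with rfl | hx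
  · right; simp
  · left; rw [coe_finRotate_of_ne_last hx]

/-- The action of the Temperley–Lieb generator of `x` and `y` on matchings: it connects `x`
with `y`, and the former partners of `x` and `y` with each other. -/
def reconnect (τ : Fin L → Fin L) (x y z : Fin L) : Fin L :=
  if z = x then y else if z = y then x else if z = τ x then τ y else if z = τ y then τ x else τ z

lemma IsNonCrossing.between_iff {τ : Fin L → Fin L} (h : IsNonCrossing τ) (c p : Fin L) :
    (c < p ∧ p < τ c) ↔ (c < τ p ∧ τ p < τ c) := by
  refine ⟨fun h' => h.nest _ _ h'.1 h'.2, fun h' => ?_⟩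
  have := h.nest _ _ h'.1 h'.2
  rwa [h.invol] at this

/-- No site lies strictly between successive sites, also around the ring: so both lie under an
arc as soon as one of them does. -/
lemma Successive.between_iff {x y : Fin L} (hs : Successive x y) {c d : Fin L} (hcx : c ≠ x)
    (hcy : c ≠ y) (hdx : d ≠ x) (hdy : d ≠ y) : (c < x ∧ x < d) ↔ (c < y ∧ y < d) := by
  have := c.isLt
  have := d.isLt
  simp only [Successive, Fin.lt_def, Fin.ext_iff, ne_eq] at *
  omega

/-- If an arc with ends `p` and `d` does not separate `a` from `b`, then an arc with ends `a` and
`b` does not separate `p` from `d`. -/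
lemma between_of_not_separated {a b p d : Fin L} (hda : d ≠ a) (hdb : d ≠ b)
    (h1 : (p < a ∧ a < d) ↔ (p < b ∧ b < d)) (h2 : (d < a ∧ a < p) ↔ (d < b ∧ b < p))
    (hap : a < p) (hpb : p < b) : a < d ∧ d < b := by
  simp only [Fin.lt_def, Fin.ext_iff, ne_eq] at *
  omega

lemma IsNonCrossing.reconnect {τ : Fin L → Fin L} (h : IsNonCrossing τ) {x y : Fin L}
    (hs : Successive x y) (hxy : x ≠ y) : IsNonCrossing (reconnect τ x y) := by
  by_cases hτ : τ x = y
  · convert h using 1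
    funext z
    simp only [SpinRing.reconnect]
    have := h.invol
    grind
  have hi := h.invol
  have hn := h.ne
  have hax : τ x ≠ x := hn x
  have hby : τ y ≠ y := hn y
  have hbx : τ y ≠ x := fun h' => hτ (by rw [← h', hi])
  have hab : τ x ≠ τ y := fun h' => hxy (h.eq_of_eq h')
  have rx : SpinRing.reconnect τ x y x = y := by simp [SpinRing.reconnect]
  have ry : SpinRing.reconnect τ x y y = x := by simp [SpinRing.reconnect, hxy.symm]
  have ra : SpinRing.reconnect τ x y (τ x) = τ y := by simp [SpinRing.reconnect, hax, hτ]
  have rb : SpinRing.reconnect τ x y (τ y) = τ x := by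
    simp [SpinRing.reconnect, hbx, hby, hab.symm]
  have ro : ∀ z, z ≠ x → z ≠ y → z ≠ τ x → z ≠ τ y → SpinRing.reconnect τ x y z = τ z :=
    fun z h1 h2 h3 h4 => by simp [SpinRing.reconnect, h1, h2, h3, h4]
  have hinv : ∀ z, SpinRing.reconnect τ x y (SpinRing.reconnect τ x y z) = z := by
    intro z
    simp only [SpinRing.reconnect]
    grind
  have ho : ∀ z, z ≠ x → z ≠ y → z ≠ τ x → z ≠ τ y →
      τ z ≠ x ∧ τ z ≠ y ∧ τ z ≠ τ x ∧ τ z ≠ τ y := fun z h1 h2 h3 h4 =>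
    ⟨fun h' => h3 (by rw [← h', hi]), fun h' => h4 (by rw [← h', hi]),
      fun h' => h1 (h.eq_of_eq h'), fun h' => h2 (h.eq_of_eq h')⟩
  -- An arc away from `x` and `y` separates neither `x` from `y` nor their partners.
  have hsep : ∀ c, c ≠ x → c ≠ y → c ≠ τ x → c ≠ τ y →
      ((c < τ x ∧ τ x < τ c) ↔ (c < τ y ∧ τ y < τ c)) := by
    intro c h1 h2 h3 h4
    obtain ⟨h5, h6, -, -⟩ := ho c h1 h2 h3 h4
    rw [← h.between_iff c x, ← h.between_iff c y]
    exact hs.between_iff h1 h2 h5 h6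
  refine ⟨hinv, fun z => ?_, fun c p hcp hpc => ?_⟩
  · simp only [SpinRing.reconnect]
    grind
  by_cases c1 : c = x
  · subst c1
    rw [rx] at hpc
    have := p.isLt
    simp only [Successive, Fin.lt_def] at *
    omega
  by_cases c2 : c = y
  · subst c2
    rw [ry] at hpc ⊢
    have h1 : SpinRing.reconnect τ x c p ≠ c := fun h' => by
      have := hinv p
      rw [h', ry] at this
      exact hpc.ne this.symm
    have h2 : SpinRing.reconnect τ x c p ≠ x := fun h' => by
      have := hinv p
      rw [h', rx] at this
      exact hcp.ne this
    have := (SpinRing.reconnect τ x c p).isLt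
    simp only [Successive, Fin.lt_def, Fin.ext_iff, ne_eq] at *
    omega
  have hother : ∀ a b, a ≠ x → a ≠ y → b ≠ x → b ≠ y →
      (∀ q, q ≠ x → q ≠ y → (q = τ x ∨ q = τ y) → q = a ∨ q = b) →
      (a = τ x ∧ b = τ y ∨ a = τ y ∧ b = τ x) → a < p → p < b →
      a < SpinRing.reconnect τ x y p ∧ SpinRing.reconnect τ x y p < b := by
    intro a b hax' hay' hbx' hby' hq hab' hap hpb
    by_cases p1 : p = x
    · subst p1; rw [rx]
      exact (hs.between_iff hax' hay' hbx' hby').1 ⟨hap, hpb⟩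
    by_cases p2 : p = y
    · subst p2; rw [ry]
      exact (hs.between_iff hax' hay' hbx' hby').2 ⟨hap, hpb⟩
    have p3 : p ≠ τ x := fun h' => by
      rcases hq p p1 p2 (.inl h') with h | h
      exacts [hap.ne' h, hpb.ne h]
    have p4 : p ≠ τ y := fun h' => by
      rcases hq p p1 p2 (.inr h') with h | h
      exacts [hap.ne' h, hpb.ne h]
    obtain ⟨d1, d2, d3, d4⟩ := ho p p1 p2 p3 p4
    have s1 := hsep p p1 p2 p3 p4
    have s2 := hsep (τ p) d1 d2 d3 d4
    rw [hi] at s2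
    rw [ro p p1 p2 p3 p4]
    rcases hab' with ⟨rfl, rfl⟩ | ⟨rfl, rfl⟩
    · exact between_of_not_separated d3 d4 s1 s2 hap hpb
    · exact between_of_not_separated d4 d3 s1.symm s2.symm hap hpb
  by_cases c3 : c = τ x
  · subst c3
    rw [ra] at hpc ⊢
    exact hother _ _ hax hτ hbx hby (fun _ _ _ h' => h') (.inl ⟨rfl, rfl⟩) hcp hpc
  by_cases c4 : c = τ y
  · subst c4
    rw [rb] at hpc ⊢
    exact hother _ _ hbx hby hax hτ (fun _ _ _ h' => h'.symm) (.inr ⟨rfl, rfl⟩) hcp hpc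
  rw [ro c c1 c2 c3 c4] at hpc ⊢
  obtain ⟨d1, d2, d3, d4⟩ := ho c c1 c2 c3 c4
  by_cases p1 : p = x
  · subst p1; rw [rx]
    exact (hs.between_iff c1 c2 d1 d2).1 ⟨hcp, hpc⟩
  by_cases p2 : p = y
  · subst p2; rw [ry]
    exact (hs.between_iff c1 c2 d1 d2).2 ⟨hcp, hpc⟩
  by_cases p3 : p = τ x
  · subst p3; rw [ra]
    exact (hsep c c1 c2 c3 c4).1 ⟨hcp, hpc⟩
  by_cases p4 : p = τ y
  · subst p4; rw [rb]
    exact (hsep c c1 c2 c3 c4).2 ⟨hcp, hpc⟩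
  rw [ro p p1 p2 p3 p4]
  exact h.nest c p hcp hpc

/-- Without crossings, the orientations of the arcs before and after a reconnection of
successive sites always differ by the same sign. -/
lemma IsNonCrossing.sign_reconnect {τ : Fin L → Fin L} (h : IsNonCrossing τ) {x y : Fin L}
    (hs : Successive x y) (hxy : x ≠ y) (hτ : τ x ≠ y) :
    (if x < τ x then (1 : ℂ) else -1) * (if y < τ y then 1 else -1)
      = -((if x < y then 1 else -1) * if τ x < τ y then 1 else -1) := by
  have hb : ∀ c p : Fin L, ((c : ℕ) < p ∧ (p : ℕ) < τ c) ↔ ((c : ℕ) < τ p ∧ (τ p : ℕ) < τ c) :=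
    h.between_iff
  have hax : τ x ≠ x := h.ne x
  have hby : τ y ≠ y := h.ne y
  have hbx : τ y ≠ x := fun h' => hτ (by rw [← h', h.invol])
  have hab : τ x ≠ τ y := fun h' => hxy (h.eq_of_eq h')
  have hxL := x.isLt
  have hyL := y.isLt
  have haL := (τ x).isLt
  have hbL := (τ y).isLt
  have b1 := hb x y
  have b2 := hb y x
  have b3 := hb (τ x) y
  have b4 := hb (τ y) x
  simp only [h.invol] at b1 b2 b3 b4
  simp only [Successive, Fin.lt_def, Fin.ext_iff, ne_eq] at *
  split_ifs <;> first | (exfalso; omega) | norm_num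

/-- Antisymmetrizing two successive sites that are not matched reconnects their arcs. -/
lemma prod_arcFactor_sub_swap {τ : Fin L → Fin L} (h : IsNonCrossing τ) {x y : Fin L}
    (hs : Successive x y) (hxy : x ≠ y) (hτ : τ x ≠ y) (σ : Config L) :
    ∏ z, arcFactor τ σ z - ∏ z, arcFactor τ (σ ∘ Equiv.swap x y) z
      = -∏ z, arcFactor (reconnect τ x y) σ z := by
  have hax : τ x ≠ x := h.ne x
  have hby : τ y ≠ y := h.ne y
  have hbx : τ y ≠ x := fun h' => hτ (by rw [← h', h.invol])
  have hab : τ x ≠ τ y := fun h' => hxy (h.eq_of_eq h')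
  have rx : reconnect τ x y x = y := by simp [reconnect]
  have ra : reconnect τ x y (τ x) = τ y := by simp [reconnect, hax, hτ]
  have h' := h.reconnect hs hxy
  rw [prod_arcFactor_eq_of_ne h σ hxy hτ, prod_arcFactor_eq_of_ne h _ hxy hτ,
    prod_arcFactor_eq_of_ne h' σ hax.symm (by rw [rx]; exact hτ.symm), rx, ra]
  have hset : ({x, y, τ x, τ y} : Finset (Fin L)) = {x, τ x, y, τ y} := by
    rw [Finset.insert_comm y]
  have h1 : ∏ z ∈ {x, τ x, y, τ y}ᶜ, arcFactor τ (σ ∘ Equiv.swap x y) z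
      = ∏ z ∈ {x, τ x, y, τ y}ᶜ, arcFactor τ σ z := by
    refine Finset.prod_congr rfl fun z hz => ?_
    simp only [Finset.mem_compl, Finset.mem_insert, Finset.mem_singleton, not_or] at hz
    obtain ⟨z1, z2, z3, z4⟩ := hz
    have z5 : τ z ≠ x := fun h'' => z2 (by rw [← h'', h.invol])
    have z6 : τ z ≠ y := fun h'' => z4 (by rw [← h'', h.invol])
    refine arcFactor_congr rfl ?_ ?_
    · simp [Equiv.swap_apply_of_ne_of_ne z1 z3]
    · simp [Equiv.swap_apply_of_ne_of_ne z5 z6]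
  have h2 : ∏ z ∈ {x, τ x, y, τ y}ᶜ, arcFactor (reconnect τ x y) σ z
      = ∏ z ∈ {x, τ x, y, τ y}ᶜ, arcFactor τ σ z := by
    refine Finset.prod_congr rfl fun z hz => ?_
    simp only [Finset.mem_compl, Finset.mem_insert, Finset.mem_singleton, not_or] at hz
    obtain ⟨z1, z2, z3, z4⟩ := hz
    exact arcFactor_congr (by simp [reconnect, z1, z2, z3, z4]) rfl rfl
  rw [hset, h1, h2]
  simp only [pairFactor, Function.comp_apply, Equiv.swap_apply_left, Equiv.swap_apply_right,
    Equiv.swap_apply_of_ne_of_ne hax hτ, Equiv.swap_apply_of_ne_of_ne hbx hby]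
  linear_combination
    (∏ z ∈ {x, τ x, y, τ y}ᶜ, arcFactor τ σ z)
      * ((if x < τ x then (1 : ℂ) else -1) * (if y < τ y then 1 else -1)
        * singlet_plucker (σ x) (σ y) (σ (τ x)) (σ (τ y))
        + singlet (σ x) (σ y) * singlet (σ (τ x)) (σ (τ y)) * h.sign_reconnect hs hxy hτ)

lemma prod_arcFactor_swap {τ : Fin L → Fin L} (h : IsNonCrossing τ) (x : Fin L) (σ : Config L) :
    ∏ z, arcFactor τ (σ ∘ Equiv.swap x (τ x)) z = -∏ z, arcFactor τ σ z := by
  rw [prod_arcFactor_eq h _ x, prod_arcFactor_eq h σ x]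
  have h1 : ∏ z ∈ {x, τ x}ᶜ, arcFactor τ (σ ∘ Equiv.swap x (τ x)) z
      = ∏ z ∈ {x, τ x}ᶜ, arcFactor τ σ z := by
    refine Finset.prod_congr rfl fun z hz => ?_
    simp only [Finset.mem_compl, Finset.mem_insert, Finset.mem_singleton, not_or] at hz
    have z1 : τ z ≠ x := fun h'' => hz.2 (by rw [← h'', h.invol])
    have z2 : τ z ≠ τ x := fun h'' => hz.1 (h.eq_of_eq h'')
    refine arcFactor_congr rfl ?_ ?_
    · simp [Equiv.swap_apply_of_ne_of_ne hz.1 hz.2]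
    · simp [Equiv.swap_apply_of_ne_of_ne z1 z2]
  rw [h1]
  simp only [pairFactor, Function.comp_apply, Equiv.swap_apply_left, Equiv.swap_apply_right]
  rw [singlet_antisymm (σ (τ x))]
  ring

lemma ne_finRotate (hL : Even L) (x : Fin L) : x ≠ finRotate L x := by
  obtain ⟨n, rfl⟩ := hL
  have := successive_finRotate x
  intro h
  rw [← h, Successive] at this
  have := x.isLt
  omega

/-- The Temperley–Lieb generator of the site `x` and its cyclic successor, acting on
matchings. -/
noncomputable def Matching.reconnect (hL : Even L) (x : Fin L) (m : Matching L) : Matching L :=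
  Matching.ofPartner (SpinRing.reconnect (m.partner hL) x (finRotate L x))
    ((m.isNonCrossing_partner hL).reconnect (successive_finRotate x) (ne_finRotate hL x))

@[simp] lemma Matching.partner_reconnect (hL : Even L) (x : Fin L) (m : Matching L) :
    (m.reconnect hL x).partner hL = SpinRing.reconnect (m.partner hL) x (finRotate L x) :=
  Matching.partner_ofPartner hL _ _

/-- The Temperley–Lieb relations for the singlet projection of successive sites. The factor `-1/2`
does not depend on the matching, nor on whether the bond closes the ring. -/
lemma act_interaction_bracket (hL : Even L) (x : Fin L) (m : Matching L) :
    act (interaction x (finRotate L x)) (bracket m) =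
      if m.partner hL x = finRotate L x then bracket m
      else (-(1 / 2) : ℂ) • bracket (m.reconnect hL x) := by
  have h := m.isNonCrossing_partner hL
  ext σ
  rw [act_interaction (ne_finRotate hL x), bracket_apply hL, bracket_apply hL]
  split_ifs with hx
  · rw [← hx, prod_arcFactor_swap h, bracket_apply hL]
    ring
  · rw [PiLp.smul_apply, bracket_apply hL, smul_eq_mul, Matching.partner_reconnect, ← mul_sub,
      prod_arcFactor_sub_swap h (successive_finRotate x) (ne_finRotate hL x) hx]
    ring

/-- The coefficients of the Hamiltonian in the bracket basis: the number of arcs of `m` between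
successive sites on the diagonal, and `-1/2` for every reconnection of `m` to `m'`. -/
noncomputable def coeff (hL : Even L) (m' m : Matching L) : ℝ :=
  open Classical in
  ∑ x, if m.partner hL x = finRotate L x then (if m' = m then 1 else 0)
    else if m' = m.reconnect hL x then -(1 / 2) else 0

lemma act_hamiltonian_bracket (hL : Even L) (m : Matching L) :
    act (hamiltonian L) (bracket m) = ∑ m', (coeff hL m' m : ℂ) • bracket m' := by
  classical
  have : act (hamiltonian L) (bracket m)
      = ∑ x, act (interaction x (finRotate L x)) (bracket m) := by
    rw [hamiltonian, act, map_sum, LinearMap.sum_apply]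
  simp only [this, coeff, Complex.ofReal_sum, Finset.sum_smul]
  rw [Finset.sum_comm]
  refine Finset.sum_congr rfl fun x _ => ?_
  rw [act_interaction_bracket hL]
  split_ifs with hx
  · simp [apply_ite Complex.ofReal, ite_smul]
  · simp [apply_ite Complex.ofReal, ite_smul]

lemma Matching.reconnect_ne (hL : Even L) {x : Fin L} {m : Matching L}
    (hx : m.partner hL x ≠ finRotate L x) : m.reconnect hL x ≠ m := by
  intro h
  apply hx
  rw [← h, partner_reconnect]
  simp [SpinRing.reconnect]

lemma coeff_nonpos (hL : Even L) {m' m : Matching L} (hm : m' ≠ m) : coeff hL m' m ≤ 0 := by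
  rw [coeff]
  refine Finset.sum_nonpos fun x _ => ?_
  rw [if_neg hm]
  split_ifs <;> norm_num

lemma coeff_reconnect_neg (hL : Even L) {x : Fin L} {m : Matching L}
    (hx : m.partner hL x ≠ finRotate L x) : coeff hL (m.reconnect hL x) m < 0 := by
  rw [coeff]
  refine Finset.sum_neg' (fun z _ => ?_) ⟨x, Finset.mem_univ _, ?_⟩
  · rw [if_neg (Matching.reconnect_ne hL hx)]
    split_ifs <;> norm_num
  · rw [if_neg hx, if_pos rfl]
    norm_num

/-! ### The bracket basis -/

/-- A non-crossing involution is determined by its left ends: the innermost disagreement would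
leave a right end without a partner. -/
lemma IsNonCrossing.eq_of_left_iff {τ τ' : Fin L → Fin L} (h : IsNonCrossing τ)
    (h' : IsNonCrossing τ') (hl : ∀ x, x < τ x ↔ x < τ' x) : τ = τ' := by
  have hstep : ∀ (τ τ' : Fin L → Fin L), IsNonCrossing τ → IsNonCrossing τ' →
      (∀ x, x < τ x ↔ x < τ' x) → ∀ x, x < τ x → (∀ z, x < z → z < τ z → τ z = τ' z) →
      ¬ τ x < τ' x := by
    intro τ τ' h h' hl x hx ih hlt
    have hy : τ' (τ x) < τ x := by
      refine lt_of_le_of_ne (not_lt.mp fun hy => ?_) (h'.ne _)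
      rw [← hl, h.invol] at hy
      exact hx.not_gt hy
    have hz := (h'.nest x (τ x) hx hlt).1
    have hzl : τ' (τ x) < τ (τ' (τ x)) := by rw [hl, h'.invol]; exact hy
    have := ih _ hz hzl
    rw [h'.invol] at this
    exact hz.ne' (h.eq_of_eq this)
  have hleft : ∀ x, x < τ x → τ x = τ' x := by
    intro x
    induction x using WellFoundedGT.induction with
    | _ x ih =>
      intro hx
      refine le_antisymm (not_lt.mp ?_) (not_lt.mp ?_)
      · exact hstep τ' τ h' h (fun z => (hl z).symm) x ((hl x).1 hx)
          fun z hz hz' => (ih z hz ((hl z).2 hz')).symm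
      · exact hstep τ τ' h h' hl x hx ih
  funext x
  rcases lt_or_gt_of_ne (h.ne x).symm with hx | hx
  · exact hleft x hx
  · have := hleft (τ x) (by rwa [h.invol])
    rw [h.invol] at this
    nth_rw 2 [this]
    rw [h'.invol]

/-- The set of left ends of the arcs. -/
noncomputable def Matching.leftSet (m : Matching L) : Finset (Fin L) :=
  Finset.univ.map ⟨m.left, m.left_strictMono.injective⟩

lemma Matching.lt_partner_iff_mem (hL : Even L) (m : Matching L) (x : Fin L) :
    x < m.partner hL x ↔ x ∈ m.leftSet := by
  rw [lt_partner_iff, leftSet]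
  simp

lemma Matching.leftSet_injective (hL : Even L) :
    Function.Injective (Matching.leftSet (L := L)) := by
  intro m m' h
  refine partner_injective hL ((m.isNonCrossing_partner hL).eq_of_left_iff
    (m'.isNonCrossing_partner hL) fun x => ?_)
  rw [lt_partner_iff_mem, lt_partner_iff_mem, h]

/-- The spin configuration whose down spins are the sites of `A`. -/
def conf (A : Finset (Fin L)) : Config L := fun x => if x ∈ A then 1 else 0

/-- The sum of the positions of the sites of `A`. -/
def weight (A : Finset (Fin L)) : ℕ := ∑ x ∈ A, (x : ℕ)

/-- Bracket vectors are triangular with respect to the weight: the configuration with down spins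
at the left ends has the least weight of all configurations on which the vector is nonzero. -/
lemma weight_le_of_bracket_ne_zero (hL : Even L) (m : Matching L) (A : Finset (Fin L))
    (h : bracket m (conf A) ≠ 0) :
    weight m.leftSet ≤ weight A ∧ (weight m.leftSet = weight A → m.leftSet = A) := by
  rw [bracket_apply_pairs hL] at h
  have hk : ∀ k, (m.left k ∈ A ∧ m.right k ∉ A) ∨ (m.left k ∉ A ∧ m.right k ∈ A) := by
    intro k
    have := Finset.prod_ne_zero_iff.mp (right_ne_zero_of_mul h) k (Finset.mem_univ k)
    by_cases h1 : m.left k ∈ A <;> by_cases h2 : m.right k ∈ A <;>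
      simp_all [conf, singlet]
  have h1 : weight m.leftSet = ∑ k, (m.left k : ℕ) := by simp [weight, Matching.leftSet]
  have h2 : weight A = ∑ k, ((if m.left k ∈ A then (m.left k : ℕ) else 0)
      + if m.right k ∈ A then (m.right k : ℕ) else 0) := by
    have : weight A = ∑ x, if x ∈ A then (x : ℕ) else 0 := by simp [weight]
    rw [this, ← (m.endsEquiv hL).sum_comp, Fintype.sum_sum_type, Finset.sum_add_distrib]
    rfl
  have hle : ∀ k ∈ Finset.univ, (m.left k : ℕ) ≤ (if m.left k ∈ A then (m.left k : ℕ) else 0)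
      + if m.right k ∈ A then (m.right k : ℕ) else 0 := by
    intro k _
    have := Fin.lt_def.mp (m.left_lt_right k)
    rcases hk k with ⟨h3, h4⟩ | ⟨h3, h4⟩ <;> simp only [h3, h4, if_true, if_false] <;> omega
  refine ⟨by rw [h1, h2]; exact Finset.sum_le_sum hle, fun heq => ?_⟩
  have hl : ∀ k, m.left k ∈ A ∧ m.right k ∉ A := by
    intro k
    rw [h1, h2, Finset.sum_eq_sum_iff_of_le hle] at heq
    have h3 := heq k (Finset.mem_univ k)
    have := Fin.lt_def.mp (m.left_lt_right k)
    rcases hk k with h4 | ⟨h4, h5⟩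
    · exact h4
    · simp only [h4, h5, if_true, if_false] at h3
      omega
  ext x
  simp only [Matching.leftSet, Finset.mem_map, Finset.mem_univ, true_and,
    Function.Embedding.coeFn_mk]
  obtain ⟨k, rfl⟩ | ⟨k, rfl⟩ := m.exists_end hL x
  · exact iff_of_true ⟨k, rfl⟩ (hl k).1
  · refine iff_of_false ?_ (hl k).2
    rintro ⟨j, hj⟩
    exact (hl k).2 (hj ▸ (hl j).1)

lemma bracket_conf_leftSet_ne_zero (hL : Even L) (m : Matching L) :
    bracket m (conf m.leftSet) ≠ 0 := by
  rw [bracket_apply_pairs hL]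
  refine mul_ne_zero (pow_ne_zero _ (by simp)) (Finset.prod_ne_zero_iff.mpr fun k _ => ?_)
  have h1 : m.left k ∈ m.leftSet := by simp [Matching.leftSet]
  have h2 : m.right k ∉ m.leftSet := by
    rw [← Matching.lt_partner_iff_mem hL, Matching.partner_right]
    exact (m.left_lt_right k).not_gt
  simp [conf, h1, h2, singlet]

lemma linearIndependent_bracket (hL : Even L) :
    LinearIndependent ℂ (fun m : Matching L => bracket m) := by
  classical
  rw [Fintype.linearIndependent_iff]
  intro g hg
  by_contra! hne
  obtain ⟨m₀, hm₀⟩ := hne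
  -- Evaluation at the left ends of a matching of least weight isolates its coefficient.
  obtain ⟨m, hm, hmin⟩ := Finset.exists_min_image (Finset.univ.filter fun m => g m ≠ 0)
    (fun m => weight m.leftSet) ⟨m₀, by simpa using hm₀⟩
  have heval : ∑ m', g m' * bracket m' (conf m.leftSet) = 0 := by
    have := congrArg (fun ψ : Space L => ψ (conf m.leftSet)) hg
    simpa using this
  rw [Finset.sum_eq_single m] at heval
  · exact mul_ne_zero (by simpa using hm) (bracket_conf_leftSet_ne_zero hL m) heval
  · intro m' _ hm'
    by_contra hne
    have h1 := weight_le_of_bracket_ne_zero hL m' _ (right_ne_zero_of_mul hne)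
    have h2 := hmin m' (by simpa using left_ne_zero_of_mul hne)
    exact hm' (Matching.leftSet_injective hL (h1.2 (le_antisymm h1.1 h2)))
  · simp

/-- The height at position `p` of the lattice path with up steps at the sites of `A` and down
steps at the other sites. -/
def height (A : Finset (Fin L)) (p : ℕ) : ℤ :=
  ∑ x : Fin L, if (x : ℕ) < p then (if x ∈ A then 1 else -1) else 0

lemma height_succ (A : Finset (Fin L)) (x : Fin L) :
    height A (x + 1) = height A x + if x ∈ A then 1 else -1 := by
  have : ∀ z : Fin L, (if (z : ℕ) < x + 1 then (if z ∈ A then (1 : ℤ) else -1) else 0)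
      = (if (z : ℕ) < x then (if z ∈ A then 1 else -1) else 0)
        + if z = x then (if x ∈ A then 1 else -1) else 0 := by
    intro z
    rcases lt_trichotomy z x with h | rfl | h
    · have := Fin.lt_def.mp h
      simp [h.ne, this, this.trans (Nat.lt_succ_self _)]
    · simp
    · have := Fin.lt_def.mp h
      simp [h.ne', this.not_gt, show ¬ (z : ℕ) < x + 1 by omega]
  simp only [height, this, Finset.sum_add_distrib, Finset.sum_ite_eq', Finset.mem_univ, if_true]

lemma height_eq_card (A : Finset (Fin L)) (p : ℕ) :
    height A p = ((A.filter fun x : Fin L => (x : ℕ) < p).card : ℤ)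
      - (Aᶜ.filter fun x : Fin L => (x : ℕ) < p).card := by
  have : ∀ x : Fin L, (if (x : ℕ) < p then (if x ∈ A then (1 : ℤ) else -1) else 0)
      = (if x ∈ A.filter fun x : Fin L => (x : ℕ) < p then 1 else 0)
        - if x ∈ Aᶜ.filter fun x : Fin L => (x : ℕ) < p then 1 else 0 := by
    intro x
    by_cases h1 : x ∈ A <;> by_cases h2 : (x : ℕ) < p <;> simp [h1, h2]
  simp only [height, this, Finset.sum_sub_distrib, Finset.sum_ite_mem, Finset.univ_inter,
    Finset.sum_const, nsmul_eq_mul, mul_one]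

lemma height_last (hL : Even L) (A : Finset (Fin L)) (hA : A.card = L / 2) : height A L = 0 := by
  rw [height_eq_card, Finset.filter_true_of_mem fun (x : Fin L) _ => x.isLt,
    Finset.filter_true_of_mem fun (x : Fin L) _ => x.isLt, Finset.card_compl, Fintype.card_fin, hA]
  obtain ⟨n, rfl⟩ := hL
  omega

/-- An up step of a nonnegative path that ends at height zero is matched with the first later step
that leads back to its height. -/
lemma exists_return (A : Finset (Fin L)) (hlast : height A L = 0)
    (hpos : ∀ p ≤ L, 0 ≤ height A p) (x : Fin L) (hx : x ∈ A) :
    ∃ y : Fin L, x < y ∧ y ∉ A ∧ height A (y + 1) = height A x ∧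
      ∀ q : ℕ, (x : ℕ) < q → q ≤ y → height A x < height A q := by
  classical
  have hex : ∃ q : ℕ, (x : ℕ) < q ∧ q ≤ L ∧ height A q ≤ height A x :=
    ⟨L, x.isLt, le_rfl, hlast ▸ hpos x x.isLt.le⟩
  obtain ⟨h1, h2, h3⟩ := Nat.find_spec hex
  have hmin := fun q => Nat.find_min (m := q) hex
  set q := Nat.find hex
  have hxs := height_succ A x
  rw [if_pos hx] at hxs
  have hq1 : q ≠ x + 1 := fun h => by rw [h, hxs] at h3; omega
  have hyL : q - 1 < L := by omega
  have hq : ((⟨q - 1, hyL⟩ : Fin L) : ℕ) + 1 = q := by simp only; omega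
  have hys := height_succ A ⟨q - 1, hyL⟩
  rw [hq] at hys
  have hlow : ∀ r : ℕ, (x : ℕ) < r → r ≤ q - 1 → height A x < height A r := by
    intro r hr1 hr2
    by_contra hcon
    exact hmin r (by omega) ⟨hr1, by omega, not_lt.mp hcon⟩
  have hy := hlow (q - 1) (by omega) le_rfl
  simp only at hys
  have hyA : (⟨q - 1, hyL⟩ : Fin L) ∉ A := fun h => by
    rw [if_pos h] at hys; omega
  rw [if_neg hyA] at hys
  refine ⟨⟨q - 1, hyL⟩, Fin.lt_def.mpr (by simp only; omega), hyA, ?_, hlow⟩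
  rw [hq]
  omega

/-- Every Dyck path is the path of a non-crossing matching. -/
lemma exists_matching (hL : Even L) (A : Finset (Fin L)) (hA : A.card = L / 2)
    (hpos : ∀ p ≤ L, 0 ≤ height A p) : ∃ m : Matching L, m.leftSet = A := by
  have hex := exists_return A (height_last hL A hA) hpos
  choose! r hr1 hr2 hr3 hr4 using hex
  have hnest : ∀ x ∈ A, ∀ x' ∈ A, x < x' → x' < r x → r x' < r x := by
    intro x hx x' hx' h1 h2
    have h3 := hr4 x hx x' h1 (Fin.lt_def.mp h2).le
    by_contra hcon
    rcases (not_lt.mp hcon).eq_or_lt with h4 | h4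
    · have h5 := hr3 x hx
      rw [h4, hr3 x' hx'] at h5
      omega
    · have h5 := hr4 x' hx' (r x + 1) (by have := Fin.lt_def.mp h2; omega) (Fin.lt_def.mp h4)
      rw [hr3 x hx] at h5
      omega
  have hlA : ∀ k, A.orderEmbOfFin hA k ∈ A := fun k => Finset.orderEmbOfFin_mem A hA k
  have hrinj : ∀ x ∈ A, ∀ x' ∈ A, r x = r x' → x = x' := by
    intro x hx x' hx' h
    rcases lt_trichotomy x x' with h1 | h1 | h1
    · exact absurd (hnest x hx x' hx' h1 (h ▸ hr1 x' hx')) (by rw [h]; exact lt_irrefl _)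
    · exact h1
    · exact absurd (hnest x' hx' x hx h1 (h ▸ hr1 x hx)) (by rw [h]; exact lt_irrefl _)
  have hinj : Function.Injective
      (Sum.elim (A.orderEmbOfFin hA) fun k => r (A.orderEmbOfFin hA k)) := by
    rw [Sum.elim_injective]
    refine ⟨(A.orderEmbOfFin hA).injective, fun j k h => ?_, fun j k h => ?_⟩
    · exact (A.orderEmbOfFin hA).injective (hrinj _ (hlA j) _ (hlA k) h)
    · exact hr2 _ (hlA k) (h ▸ hlA j)
  have hsurj : Function.Surjective
      (Sum.elim (A.orderEmbOfFin hA) fun k => r (A.orderEmbOfFin hA k)) := by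
    refine ((Fintype.bijective_iff_injective_and_card _).mpr ⟨hinj, ?_⟩).2
    simp only [Fintype.card_sum, Fintype.card_fin]
    obtain ⟨n, rfl⟩ := hL
    omega
  refine ⟨{ left := A.orderEmbOfFin hA
            right := fun k => r (A.orderEmbOfFin hA k)
            left_strictMono := OrderEmbedding.strictMono _
            left_lt_right := fun k => hr1 _ (hlA k)
            cover := by rw [← Set.Sum.elim_range, hsurj.range_eq]
            noncrossing := fun j k hjk => ⟨fun ⟨h1, h2⟩ => ?_, fun ⟨h1, h2⟩ => ?_⟩ }, ?_⟩
  · exact ⟨h1.trans (hr1 _ (hlA j)), hnest _ (hlA k) _ (hlA j) h1 h2⟩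
  · refine ⟨?_, (hr1 _ (hlA j)).trans h2⟩
    rcases lt_trichotomy (A.orderEmbOfFin hA k) (A.orderEmbOfFin hA j) with h3 | h3 | h3
    · exact h3
    · exact absurd ((A.orderEmbOfFin hA).injective h3) hjk.symm
    · exact absurd (hnest _ (hlA j) _ (hlA k) h3 h1) h2.not_gt
  · ext x
    have := Finset.range_orderEmbOfFin A hA
    simp only [Matching.leftSet, Finset.mem_map, Finset.mem_univ, true_and,
      Function.Embedding.coeFn_mk]
    rw [← Finset.mem_coe, ← this]
    rfl

section Garnir

variable {n : ℕ} {φ : Finset (Fin L) → ℂ}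

/-- The relation with one free down spin extends to any number of free down spins. -/
lemma sum_superset_eq_zero (hcard : ∀ A, A.card ≠ n → φ A = 0)
    (hraise : ∀ B, ∑ x ∈ Bᶜ, φ (insert x B) = 0) (k : ℕ) (P : Finset (Fin L))
    (hP : P.card + k + 1 = n) : ∑ A with P ⊆ A, φ A = 0 := by
  induction k generalizing P with
  | zero =>
    rw [← hraise P]
    have hstep : ∀ A ∈ Finset.univ.filter fun A => P ⊆ A, φ A ≠ 0 →
        ∃ x ∈ Pᶜ, insert x P = A := by
      intro A hA hne
      have hPA : P ⊆ A := by simpa using hA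
      have hAn : A.card = n := by by_contra h; exact hne (hcard A h)
      have h1 : (A \ P).card = 1 := by rw [Finset.card_sdiff_of_subset hPA]; omega
      obtain ⟨x, hx⟩ := Finset.card_eq_one.mp h1
      refine ⟨x, ?_, ?_⟩
      · have : x ∈ A \ P := by rw [hx]; simp
        simpa using (Finset.mem_sdiff.mp this).2
      · rw [← Finset.singleton_union, ← hx, Finset.sdiff_union_of_subset hPA]
    symm
    refine Finset.sum_bij_ne_zero (fun x _ _ => insert x P) ?_ ?_ ?_ ?_
    · intro x _ _
      simp
    · intro x hx _ y hy _ hxy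
      have : x ∈ insert y P := hxy ▸ Finset.mem_insert_self x P
      exact (Finset.mem_insert.mp this).resolve_right (by simpa using hx)
    · intro A hA hne
      obtain ⟨x, hx, rfl⟩ := hstep A hA hne
      exact ⟨x, hx, hne, rfl⟩
    · intros; rfl
  | succ k ih =>
    -- Both sides count the pairs of a set `A ⊇ P` and a site of `A \ P`.
    have hcount : ∑ x ∈ Pᶜ, ∑ A with insert x P ⊆ A, φ A
        = ((k : ℂ) + 2) * ∑ A with P ⊆ A, φ A := by
      have h1 : ∀ x ∈ Pᶜ, ∑ A with insert x P ⊆ A, φ A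
          = ∑ A with P ⊆ A, if x ∈ A then φ A else 0 := by
        intro x _
        rw [← Finset.sum_filter, Finset.filter_filter]
        refine Finset.sum_congr ?_ fun _ _ => rfl
        ext A
        simp [Finset.insert_subset_iff, and_comm]
      rw [Finset.sum_congr rfl h1, Finset.sum_comm, Finset.mul_sum]
      refine Finset.sum_congr rfl fun A hA => ?_
      rw [← Finset.sum_filter, Finset.sum_const, nsmul_eq_mul]
      by_cases hAn : A.card = n
      · have h2 : Finset.filter (fun x => x ∈ A) Pᶜ = A \ P := by
          ext x; simp [and_comm]
        rw [h2, Finset.card_sdiff_of_subset (by simpa using hA), hAn, ← hP]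
        congr 1
        rw [show P.card + (k + 1) + 1 - P.card = k + 2 by omega]
        push_cast; ring
      · rw [hcard A hAn]; ring
    have hzero : ∑ x ∈ Pᶜ, ∑ A with insert x P ⊆ A, φ A = 0 := by
      refine Finset.sum_eq_zero fun x hx => ih _ ?_
      rw [Finset.card_insert_of_notMem (by simpa using hx)]
      omega
    rw [hcount] at hzero
    refine (mul_eq_zero.mp hzero).resolve_left ?_
    exact_mod_cast Nat.succ_ne_zero (k + 1)

/-- A Garnir relation: prescribing fewer than `n` spins and summing over all others, which
amounts to a symmetrization over more than `n` sites, gives zero. -/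
lemma sum_superset_disjoint_eq_zero (hcard : ∀ A, A.card ≠ n → φ A = 0)
    (hraise : ∀ B, ∑ x ∈ Bᶜ, φ (insert x B) = 0) (Q P : Finset (Fin L))
    (hPQ : P.card + Q.card < n) : ∑ A with P ⊆ A ∧ Disjoint A Q, φ A = 0 := by
  induction Q using Finset.induction generalizing P with
  | empty =>
    simp only [Finset.disjoint_empty_right, and_true]
    rw [Finset.card_empty] at hPQ
    exact sum_superset_eq_zero hcard hraise (n - P.card - 1) P (by omega)
  | insert q Q hq ih =>
    rw [Finset.card_insert_of_notMem hq] at hPQ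
    have h1 := ih P (by omega)
    have h2 := ih (insert q P) (by have := Finset.card_insert_le q P; omega)
    rw [← Finset.sum_filter_add_sum_filter_not _ (fun A => q ∈ A), Finset.filter_filter,
      Finset.filter_filter] at h1
    have h3 : (Finset.univ.filter fun A => (P ⊆ A ∧ Disjoint A Q) ∧ q ∈ A)
        = Finset.univ.filter fun A => insert q P ⊆ A ∧ Disjoint A Q := by
      ext A; simp [Finset.insert_subset_iff]; tauto
    have h4 : (Finset.univ.filter fun A => (P ⊆ A ∧ Disjoint A Q) ∧ q ∉ A)
        = Finset.univ.filter fun A => P ⊆ A ∧ Disjoint A (insert q Q) := by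
      ext A; simp [Finset.disjoint_insert_right]; tauto
    rw [h3, h4, h2, zero_add] at h1
    exact h1

/-- Moving a set of down spins from positions at least `p` to positions less than `p` lowers the
weight. -/
lemma weight_lt_of_exchange {A A' : Finset (Fin L)} (p : ℕ) (hAA' : A.card = A'.card)
    (hne : A' ≠ A) (h1 : ∀ x ∈ A' \ A, (x : ℕ) < p) (h2 : ∀ x ∈ A \ A', p ≤ (x : ℕ)) :
    weight A' < weight A := by
  have hc : (A' \ A).card = (A \ A').card := by
    have := Finset.card_sdiff_add_card_inter A' A
    have := Finset.card_sdiff_add_card_inter A A'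
    rw [Finset.inter_comm] at this
    omega
  have hpos : (A' \ A).Nonempty := by
    rw [Finset.sdiff_nonempty]
    intro hsub
    exact hne (Finset.eq_of_subset_of_card_le hsub hAA'.le)
  have h3 : ∑ x ∈ A' \ A, (x : ℕ) < (A' \ A).card * p := by
    rw [← smul_eq_mul, ← Finset.sum_const]
    exact Finset.sum_lt_sum_of_nonempty hpos h1
  have h4 : (A \ A').card * p ≤ ∑ x ∈ A \ A', (x : ℕ) := by
    rw [← smul_eq_mul]
    exact Finset.card_nsmul_le_sum _ _ _ h2
  have h5 := Finset.sum_inter_add_sum_sdiff A A' (fun x : Fin L => (x : ℕ))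
  have h6 := Finset.sum_inter_add_sum_sdiff A' A (fun x : Fin L => (x : ℕ))
  rw [Finset.inter_comm] at h6
  rw [hc] at h3
  simp only [weight]
  omega

/-- The values on the left-end configurations of matchings determine the others: outside the Dyck
paths, a Garnir relation expresses the value by values on configurations of lower weight. -/
lemma eq_zero_of_eq_zero_on_leftSet (hL : Even L) (hcard : ∀ A, A.card ≠ L / 2 → φ A = 0)
    (hraise : ∀ B, ∑ x ∈ Bᶜ, φ (insert x B) = 0) (hm : ∀ m : Matching L, φ m.leftSet = 0)
    (A : Finset (Fin L)) : φ A = 0 := by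
  induction hw : weight A using Nat.strong_induction_on generalizing A with
  | _ w ih =>
  subst hw
  by_cases hA : A.card = L / 2
  swap
  · exact hcard A hA
  by_cases hpos : ∀ p ≤ L, 0 ≤ height A p
  · obtain ⟨m, rfl⟩ := exists_matching hL A hA hpos
    exact hm m
  push Not at hpos
  obtain ⟨p, -, hp⟩ := hpos
  -- Keep the down spins before `p` and the up spins from `p` on.
  have hgar := sum_superset_disjoint_eq_zero hcard hraise
    (Aᶜ.filter fun x : Fin L => ¬ (x : ℕ) < p) (A.filter fun x : Fin L => (x : ℕ) < p) (by
      rw [height_eq_card] at hp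
      have h1 := Finset.card_filter_add_card_filter_not (s := Aᶜ)
        (fun x : Fin L => (x : ℕ) < p)
      rw [Finset.card_compl, Fintype.card_fin, hA] at h1
      obtain ⟨n, rfl⟩ := hL
      omega)
  rw [Finset.sum_eq_single_of_mem A] at hgar
  · exact hgar
  · simp only [Finset.mem_filter, Finset.mem_univ, true_and]
    refine ⟨Finset.filter_subset _ _, ?_⟩
    rw [Finset.disjoint_right]
    intro x hx
    simpa using (Finset.mem_filter.mp hx).1
  · intro A' hA' hne
    simp only [Finset.mem_filter, Finset.mem_univ, true_and, Finset.disjoint_right,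
      Finset.subset_iff, Finset.mem_compl] at hA'
    obtain ⟨h1, h2⟩ := hA'
    by_cases hc : A'.card = L / 2
    swap
    · exact hcard A' hc
    refine ih _ (weight_lt_of_exchange p (hA.trans hc.symm) hne ?_ ?_) A' rfl
    · intro x hx
      rw [Finset.mem_sdiff] at hx
      by_contra hxp
      exact h2 ⟨hx.2, hxp⟩ hx.1
    · intro x hx
      rw [Finset.mem_sdiff] at hx
      by_contra hxp
      exact hx.2 (h1 ⟨hx.1, not_le.mp hxp⟩)

end Garnir

lemma conf_surjective : Function.Surjective (conf (L := L)) := by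
  intro σ
  refine ⟨Finset.univ.filter fun x => σ x = 1, ?_⟩
  funext x
  simp only [conf, Finset.mem_filter, Finset.mem_univ, true_and]
  split_ifs <;> omega

/-- In the spin-zero sector, half of the spins point down. -/
lemma apply_conf_eq_zero_of_card_ne (hL : Even L) {ψ : Space L} (hψ : ψ ∈ sector L 0)
    (A : Finset (Fin L)) (hA : A.card ≠ L / 2) : ψ (conf A) = 0 := by
  have h := congrArg (fun φ : Space L => φ (conf A)) ((mem_sector_zero_iff ψ).1 hψ 2)
  simp only [act_totalSpin, PiLp.zero_apply] at h
  have h1 : ∀ x, ∑ s, spin 2 (conf A x) s * ψ (Function.update (conf A) x s)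
      = (1 / 2 - if x ∈ A then 1 else 0) * ψ (conf A) := by
    intro x
    have h2 : ∀ s, spin 2 (conf A x) s * ψ (Function.update (conf A) x s)
        = if s = conf A x then spin 2 (conf A x) s * ψ (conf A) else 0 := by
      intro s
      split_ifs with hs
      · rw [hs, Function.update_eq_self]
      · have : spin 2 (conf A x) s = 0 := by
          revert hs
          generalize conf A x = t
          fin_cases s <;> fin_cases t <;> simp [spin]
        rw [this, zero_mul]
    simp only [h2, Finset.sum_ite_eq', Finset.mem_univ, if_true]
    congr 1
    by_cases hx : x ∈ A
    · simp [conf, hx, spin]; norm_num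
    · simp [conf, hx, spin]
  simp only [h1, ← Finset.sum_mul, Finset.sum_sub_distrib] at h
  refine (mul_eq_zero.mp h).resolve_left ?_
  simp only [Finset.sum_const, Finset.card_univ, Fintype.card_fin, Finset.sum_ite_mem,
    Finset.univ_inter, nsmul_eq_mul, mul_one]
  obtain ⟨n, rfl⟩ := hL
  intro h0
  apply hA
  have : (n : ℂ) = A.card := by
    push_cast at h0
    linear_combination h0
  have := Nat.cast_injective this
  omega

lemma sum_apply_conf_insert {ψ : Space L} (hψ : ψ ∈ sector L 0) (B : Finset (Fin L)) :
    ∑ x ∈ Bᶜ, ψ (conf (insert x B)) = 0 := by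
  have h := fun ν => congrArg (fun φ : Space L => φ (conf B)) ((mem_sector_zero_iff ψ).1 hψ ν)
  simp only [act_totalSpin, PiLp.zero_apply] at h
  -- The combination `S⁽¹⁾ + i S⁽²⁾` raises the spin.
  have h1 : ∑ x, ∑ s, (spin 0 (conf B x) s + Complex.I * spin 1 (conf B x) s)
      * ψ (Function.update (conf B) x s) = 0 := by
    simp only [add_mul, Finset.sum_add_distrib, mul_assoc, ← Finset.mul_sum, h]
    simp
  rw [← h1, ← Finset.sum_subset (Finset.subset_univ Bᶜ)]
  · refine Finset.sum_congr rfl fun x hx => ?_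
    have hxB : x ∉ B := by simpa using hx
    have h2 : Function.update (conf B) x 1 = conf (insert x B) := by
      funext z
      by_cases hz : z = x
      · subst hz; simp [conf]
      · simp [conf, hz]
    have h3 : conf B x = 0 := by simp [conf, hxB]
    rw [Fin.sum_univ_two, h3, h2]
    simp [spin]
    ring_nf
    simp
    ring
  · intro x _ hx
    have h3 : conf B x = 1 := by simp [conf, by simpa using hx]
    rw [Fin.sum_univ_two, h3]
    simp [spin]
    ring_nf
    simp

lemma eq_zero_of_apply_leftSet_eq_zero (hL : Even L) {ψ : Space L} (hψ : ψ ∈ sector L 0)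
    (h : ∀ m : Matching L, ψ (conf m.leftSet) = 0) : ψ = 0 := by
  ext σ
  obtain ⟨A, rfl⟩ := conf_surjective σ
  exact eq_zero_of_eq_zero_on_leftSet hL (apply_conf_eq_zero_of_card_ne hL hψ)
    (sum_apply_conf_insert hψ) h A

lemma finrank_sector (hL : Even L) :
    Fintype.card (Matching L) = Module.finrank ℂ (sector L 0) := by
  refine le_antisymm ?_ ?_
  · refine LinearIndependent.fintype_card_le_finrank
      (b := fun m : Matching L => (⟨bracket m, bracket_mem_sector hL m⟩ : sector L 0)) ?_
    exact LinearIndependent.of_comp (sector L 0).subtype (linearIndependent_bracket hL)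
  · let ev : sector L 0 →ₗ[ℂ] (Matching L → ℂ) :=
      { toFun := fun ψ m => (ψ : Space L) (conf m.leftSet)
        map_add' := fun _ _ => rfl
        map_smul' := fun _ _ => rfl }
    have hev : Function.Injective ev := by
      rw [injective_iff_map_eq_zero]
      intro ψ hψ
      exact Subtype.ext (eq_zero_of_apply_leftSet_eq_zero hL ψ.2 fun m => congrFun hψ m)
    simpa using LinearMap.finrank_le_finrank_of_injective hev

/-- The Hulthén bracket basis of the spin-zero sector. -/
noncomputable def bracketBasis (hL : Even L) : Module.Basis (Matching L) ℂ (sector L 0) :=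
  basisOfLinearIndependentOfCardEqFinrank'
    (fun m => ⟨bracket m, bracket_mem_sector hL m⟩)
    (LinearIndependent.of_comp (sector L 0).subtype (linearIndependent_bracket hL))
    (finrank_sector hL)

@[simp] lemma coe_bracketBasis (hL : Even L) (m : Matching L) :
    (bracketBasis hL m : Space L) = bracket m := by
  simp [bracketBasis]

/-! ### Ground states of real symmetric operators with nonpositive off-diagonal entries -/

section PerronFrobenius

variable {ι : Type*} [Fintype ι]

/-- A nonnegative eigenvector of an irreducible matrix with nonpositive off-diagonal entries is
positive, because the set of its positive entries is closed under the transitions. -/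
lemma eigenvector_pos {a : ι → ι → ℝ} (hoff : ∀ i j, i ≠ j → a i j ≤ 0)
    (hirr : ∀ S : Set ι, S.Nonempty → (∀ j ∈ S, ∀ i, a i j < 0 → i ∈ S) → S = Set.univ)
    {e : ℝ} {v : ι → ℝ} (hv : ∀ i, ∑ j, a i j * v j = e * v i) (hnonneg : ∀ i, 0 ≤ v i)
    (hne : ∃ i, v i ≠ 0) (i : ι) : 0 < v i := by
  have hS : {i | 0 < v i} = Set.univ := by
    refine hirr _ ?_ fun j hj i hij => ?_
    · obtain ⟨i, hi⟩ := hne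
      exact ⟨i, lt_of_le_of_ne (hnonneg i) hi.symm⟩
    · rw [Set.mem_ofPred_eq] at hj ⊢
      by_contra hi
      have hi0 : v i = 0 := le_antisymm (not_lt.mp hi) (hnonneg i)
      have hneg : ∑ k, a i k * v k < 0 := by
        refine Finset.sum_neg' (fun k _ => ?_) ⟨j, Finset.mem_univ j, mul_neg_of_neg_of_pos hij hj⟩
        rcases eq_or_ne i k with rfl | hk
        · simp [hi0]
        · exact mul_nonpos_of_nonpos_of_nonneg (hoff i k hk) (hnonneg k)
      rw [hv i, hi0, mul_zero] at hneg
      exact lt_irrefl _ hneg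
  exact Set.eq_univ_iff_forall.mp hS i

/-- The eigenspace of a positive eigenvector `v` is a line: for any other eigenvector `w`, some
`w - t v` is nonnegative with a zero entry. -/
lemma eigenvector_unique [Nonempty ι] {a : ι → ι → ℝ} (hoff : ∀ i j, i ≠ j → a i j ≤ 0)
    (hirr : ∀ S : Set ι, S.Nonempty → (∀ j ∈ S, ∀ i, a i j < 0 → i ∈ S) → S = Set.univ)
    {e : ℝ} {v w : ι → ℝ} (hv : ∀ i, ∑ j, a i j * v j = e * v i) (hpos : ∀ i, 0 < v i)
    (hw : ∀ i, ∑ j, a i j * w j = e * w i) : ∃ t, ∀ i, w i = t * v i := by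
  obtain ⟨i₀, -, hmin⟩ :=
    Finset.exists_min_image Finset.univ (fun i => w i / v i) Finset.univ_nonempty
  refine ⟨w i₀ / v i₀, fun i => ?_⟩
  by_contra hi
  have := eigenvector_pos hoff hirr (e := e) (v := fun i => w i - w i₀ / v i₀ * v i) ?_ ?_
    ⟨i, sub_ne_zero.mpr hi⟩ i₀
  · rw [div_mul_cancel₀ _ (hpos i₀).ne', sub_self] at this
    exact lt_irrefl _ this
  · intro i
    have : ∀ j, a i j * (w j - w i₀ / v i₀ * v j)
        = a i j * w j - w i₀ / v i₀ * (a i j * v j) := fun j => by ring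
    simp only [this, Finset.sum_sub_distrib, ← Finset.mul_sum, hv, hw]
    ring
  · intro i
    have := hmin i (Finset.mem_univ i)
    rw [le_div_iff₀ (hpos i)] at this
    exact sub_nonneg.mpr this

variable {E : Type*} [NormedAddCommGroup E] [InnerProductSpace ℂ E]

lemma repr_apply_eq_sum (b : Module.Basis ι ℂ E) {H : E →ₗ[ℂ] E} {a : ι → ι → ℝ}
    (ha : ∀ j, H (b j) = ∑ i, (a i j : ℂ) • b i) (x : E) (i : ι) :
    b.repr (H x) i = ∑ j, (a i j : ℂ) * b.repr x j := by
  classical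
  conv_lhs => rw [← b.sum_repr x]
  simp only [map_sum, map_smul, ha, Finset.sum_apply', Finsupp.smul_apply, smul_eq_mul,
    Module.Basis.repr_self, Finsupp.single_apply, mul_ite, mul_one, mul_zero,
    Finset.sum_ite_eq', Finset.mem_univ, if_true]
  exact Finset.sum_congr rfl fun j _ => mul_comm _ _

open scoped ComplexOrder in
open Filter Topology in
/-- A symmetric operator whose matrix in some basis, not necessarily orthogonal, is real with
nonpositive off-diagonal entries, has a nonzero eigenvector with nonnegative coordinates at the
bottom of its spectrum. -/
lemma exists_nonneg_eigenvector [FiniteDimensional ℂ E] [Nonempty ι]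
    (b : Module.Basis ι ℂ E) {H : E →ₗ[ℂ] E}
    (hH : H.IsSymmetric) {a : ι → ι → ℝ} (ha : ∀ j, H (b j) = ∑ i, (a i j : ℂ) • b i)
    (hoff : ∀ i j, i ≠ j → a i j ≤ 0) :
    ∃ e : ℝ, (∀ x, e * ‖x‖ ^ 2 ≤ (inner ℂ x (H x)).re) ∧
      ∃ q, q ≠ 0 ∧ H q = (e : ℂ) • q ∧ ∀ i, 0 ≤ b.repr q i := by
  classical
  set u := hH.eigenvectorBasis rfl
  set μ := hH.eigenvalues rfl
  have hHu : ∀ i, H (u i) = (μ i : ℂ) • u i := hH.apply_eigenvectorBasis rfl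
  have hn : Nonempty (Fin (Module.finrank ℂ E)) := by
    rw [← Fin.pos_iff_nonempty, Module.finrank_eq_card_basis b]
    exact Fintype.card_pos
  obtain ⟨i₀, -, hmin⟩ := Finset.exists_min_image Finset.univ μ Finset.univ_nonempty
  refine ⟨μ i₀, fun x => ?_, ?_⟩
  · have h1 : inner ℂ x (H x) = ∑ i, ((μ i * ‖inner ℂ (u i) x‖ ^ 2 : ℝ) : ℂ) := by
      rw [← u.sum_inner_mul_inner x (H x)]
      refine Finset.sum_congr rfl fun i _ => ?_
      rw [← hH (u i) x, hHu, inner_smul_left, Complex.conj_ofReal, mul_left_comm,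
        ← inner_conj_symm x (u i), Complex.conj_mul']
      push_cast
      ring
    rw [h1, ← Complex.ofReal_sum, Complex.ofReal_re, ← u.sum_sq_norm_inner_right x,
      Finset.mul_sum]
    exact Finset.sum_le_sum fun i hi => mul_le_mul_of_nonneg_right (hmin i hi) (by positivity)
  -- After a shift by `c`, the powers of `T = (c - H) / (c - e)` converge to the projection onto
  -- the bottom eigenspace, and preserve nonnegative coordinates.
  obtain ⟨c, hc1, hc2⟩ : ∃ c : ℝ, (∀ j, a j j ≤ c) ∧ ∀ i, μ i < c := by
    refine ⟨∑ j, |a j j| + ∑ i, |μ i| + 1, fun j => ?_, fun i => ?_⟩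
    · have := Finset.single_le_sum (f := fun j => |a j j|) (fun _ _ => abs_nonneg _)
        (Finset.mem_univ j)
      have h2 : 0 ≤ ∑ i, |μ i| := Finset.sum_nonneg fun _ _ => abs_nonneg _
      linarith [le_abs_self (a j j)]
    · have := Finset.single_le_sum (f := fun j => |μ j|) (fun _ _ => abs_nonneg _)
        (Finset.mem_univ i)
      have h2 : 0 ≤ ∑ j, |a j j| := Finset.sum_nonneg fun _ _ => abs_nonneg _
      linarith [le_abs_self (μ i)]
  have hpos : 0 < c - μ i₀ := sub_pos.mpr (hc2 i₀)
  let T : E →ₗ[ℂ] E := (((c - μ i₀)⁻¹ : ℝ) : ℂ) • ((c : ℂ) • LinearMap.id - H)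
  let t : Fin (Module.finrank ℂ E) → ℝ := fun i => (c - μ i₀)⁻¹ * (c - μ i)
  have hTu : ∀ i, T (u i) = (t i : ℂ) • u i := by
    intro i
    simp only [T, t, LinearMap.smul_apply, LinearMap.sub_apply, LinearMap.id_apply, hHu]
    rw [← sub_smul, smul_smul]
    push_cast
    rfl
  have hTk : ∀ k i, (T ^ k) (u i) = ((t i ^ k : ℝ) : ℂ) • u i := by
    intro k i
    induction k with
    | zero => simp
    | succ k ih =>
      rw [pow_succ, Module.End.mul_apply, hTu, map_smul, ih, smul_smul]
      push_cast
      ring_nf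
  have hTnonneg : ∀ x, (∀ i, 0 ≤ b.repr x i) → ∀ i, 0 ≤ b.repr (T x) i := by
    intro x hx i
    have h1 := repr_apply_eq_sum b ha x i
    have h2 : b.repr (T x) i = (((c - μ i₀)⁻¹ : ℝ) : ℂ)
        * ∑ j, (((if i = j then c else 0) - a i j : ℝ) : ℂ) * b.repr x j := by
      simp only [T, LinearMap.smul_apply, LinearMap.sub_apply, LinearMap.id_apply, map_smul,
        map_sub, Finsupp.smul_apply, Finsupp.sub_apply, smul_eq_mul, h1]
      congr 1
      simp [sub_mul, Finset.sum_sub_distrib, apply_ite Complex.ofReal]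
    rw [h2]
    refine mul_nonneg (Complex.zero_le_real.mpr (inv_nonneg.mpr hpos.le))
      (Finset.sum_nonneg fun j _ => mul_nonneg (Complex.zero_le_real.mpr ?_) (hx j))
    split_ifs with hij
    · subst hij; linarith [hc1 i]
    · linarith [hoff i j hij]
  have ht : ∀ i, 0 ≤ t i ∧ (t i < 1 ∨ (t i = 1 ∧ μ i = μ i₀)) := by
    intro i
    refine ⟨mul_nonneg (inv_nonneg.mpr hpos.le) (sub_nonneg.mpr (hc2 i).le), ?_⟩
    rcases (hmin i (Finset.mem_univ i)).eq_or_lt with h | h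
    · right
      exact ⟨by simp only [t]; rw [← h, inv_mul_cancel₀ hpos.ne'], h.symm⟩
    · left
      simp only [t]
      rw [inv_mul_lt_one₀ hpos]
      linarith
  obtain ⟨j₀, hj₀⟩ : ∃ j, inner ℂ (u i₀) (b j) ≠ 0 := by
    by_contra! hcon
    have h1 : inner ℂ (u i₀) (∑ j, b.repr (u i₀) j • b j) = 0 := by
      simp only [inner_sum, inner_smul_right, hcon, mul_zero, Finset.sum_const_zero]
    rw [b.sum_repr] at h1
    exact (u.orthonormal.ne_zero i₀) (inner_self_eq_zero.mp h1)
  let s : Fin (Module.finrank ℂ E) → ℂ := fun i => if μ i = μ i₀ then inner ℂ (u i) (b j₀) else 0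
  refine ⟨∑ i, s i • u i, ?_, ?_, ?_⟩
  · intro h0
    have := Fintype.linearIndependent_iff.mp u.orthonormal.linearIndependent s h0 i₀
    simp only [s, if_true] at this
    exact hj₀ this
  · rw [map_sum, Finset.smul_sum]
    refine Finset.sum_congr rfl fun i _ => ?_
    rw [map_smul, hHu, smul_comm]
    by_cases h : μ i = μ i₀
    · rw [h]
    · simp [s, h]
  · intro i
    have hlim : Tendsto (fun k => b.repr ((T ^ k) (b j₀)) i) atTop
        (𝓝 (b.repr (∑ i, s i • u i) i)) := by
      have h1 : ∀ k, b.repr ((T ^ k) (b j₀)) i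
          = ∑ l, (((t l) ^ k : ℝ) : ℂ) * (inner ℂ (u l) (b j₀) * b.repr (u l) i) := by
        intro k
        conv_lhs => rw [← u.sum_repr' (b j₀)]
        simp only [map_sum, map_smul, hTk, Finset.sum_apply', Finsupp.smul_apply, smul_eq_mul]
        exact Finset.sum_congr rfl fun l _ => by ring
      have h2 : b.repr (∑ i, s i • u i) i
          = ∑ l, (if μ l = μ i₀ then 1 else 0) * (inner ℂ (u l) (b j₀) * b.repr (u l) i) := by
        simp only [map_sum, map_smul, Finset.sum_apply', Finsupp.smul_apply, smul_eq_mul, s]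
        exact Finset.sum_congr rfl fun l _ => by split_ifs <;> ring
      simp only [h1, h2]
      refine tendsto_finsetSum _ fun l _ => Tendsto.mul_const _ ?_
      rcases ht l with ⟨h3, h4 | ⟨h4, h5⟩⟩
      · have hne : μ l ≠ μ i₀ := by
          intro h
          simp only [t, h, inv_mul_cancel₀ hpos.ne', lt_irrefl] at h4
        rw [if_neg hne]
        exact (Complex.continuous_ofReal.tendsto' 0 0 (by simp)).comp
          (tendsto_pow_atTop_nhds_zero_of_lt_one h3 h4)
      · simp [h4, h5]
    refine ge_of_tendsto' hlim fun k => ?_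
    clear hlim
    induction k generalizing i with
    | zero =>
      rw [pow_zero, Module.End.one_apply, b.repr_self, Finsupp.single_apply]
      split_ifs <;> simp
    | succ k ih =>
      rw [pow_succ', Module.End.mul_apply]
      exact hTnonneg _ ih i

/-- A symmetric operator whose matrix in some basis is real, irreducible, and nonpositive off the
diagonal, has a simple lowest eigenvalue, with an eigenvector of positive coordinates. -/
theorem exists_pos_ground_state [FiniteDimensional ℂ E] [Nonempty ι] (b : Module.Basis ι ℂ E)
    {H : E →ₗ[ℂ] E} (hH : H.IsSymmetric) {a : ι → ι → ℝ}
    (ha : ∀ j, H (b j) = ∑ i, (a i j : ℂ) • b i) (hoff : ∀ i j, i ≠ j → a i j ≤ 0)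
    (hirr : ∀ S : Set ι, S.Nonempty → (∀ j ∈ S, ∀ i, a i j < 0 → i ∈ S) → S = Set.univ) :
    ∃ e : ℝ, (∀ x, e * ‖x‖ ^ 2 ≤ (inner ℂ x (H x)).re) ∧
      ∃ Θ, Θ ≠ 0 ∧ H Θ = (e : ℂ) • Θ ∧ (∀ i, ∃ r : ℝ, 0 < r ∧ b.repr Θ i = (r : ℂ)) ∧
        ∀ ψ, H ψ = (e : ℂ) • ψ → ∃ c : ℂ, c • Θ = ψ := by
  obtain ⟨e, hlow, Θ, hΘ, heig, hnonneg⟩ := exists_nonneg_eigenvector b hH ha hoff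
  -- The matrix is real, so the real and imaginary parts of the coordinates of an eigenvector are
  -- eigenvectors, too.
  have hcoord : ∀ ψ, H ψ = (e : ℂ) • ψ → ∀ i,
      ∑ j, (a i j : ℂ) * b.repr ψ j = (e : ℂ) * b.repr ψ i := by
    intro ψ hψ i
    rw [← repr_apply_eq_sum b ha, hψ, map_smul, Finsupp.smul_apply, smul_eq_mul]
  have hre : ∀ ψ, H ψ = (e : ℂ) • ψ → ∀ i,
      ∑ j, a i j * (b.repr ψ j).re = e * (b.repr ψ i).re := by
    intro ψ hψ i
    simpa using congrArg Complex.re (hcoord ψ hψ i)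
  have him : ∀ ψ, H ψ = (e : ℂ) • ψ → ∀ i,
      ∑ j, a i j * (b.repr ψ j).im = e * (b.repr ψ i).im := by
    intro ψ hψ i
    simpa using congrArg Complex.im (hcoord ψ hψ i)
  have hreal : ∀ i, b.repr Θ i = ((b.repr Θ i).re : ℂ) := fun i =>
    Complex.ext rfl (Complex.nonneg_iff.mp (hnonneg i)).2.symm
  have hpos : ∀ i, 0 < (b.repr Θ i).re := by
    refine eigenvector_pos hoff hirr (hre Θ heig)
      (fun i => (Complex.nonneg_iff.mp (hnonneg i)).1) ?_
    by_contra! hcon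
    refine hΘ (b.repr.map_eq_zero_iff.mp (Finsupp.ext fun i => ?_))
    rw [hreal, hcon]
    simp
  refine ⟨e, hlow, Θ, hΘ, heig, fun i => ⟨_, hpos i, hreal i⟩, fun ψ hψ => ?_⟩
  obtain ⟨s, hs⟩ := eigenvector_unique hoff hirr (hre Θ heig) hpos (hre ψ hψ)
  obtain ⟨t, ht⟩ := eigenvector_unique hoff hirr (hre Θ heig) hpos (him ψ hψ)
  refine ⟨⟨s, t⟩, b.repr.injective (Finsupp.ext fun i => ?_)⟩
  rw [map_smul, Finsupp.smul_apply, smul_eq_mul, hreal]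
  apply Complex.ext
  · simp [hs]
  · simp [ht]

end PerronFrobenius

/-! ### Irreducibility of the reconnections, and the ground state -/

/-- A matching is flat if no two neighbouring sites are both left ends; this singles out the
matching of the pairs `(0, 1), (2, 3), …`. -/
def IsFlat (τ : Fin L → Fin L) : Prop :=
  ∀ x y : Fin L, (x : ℕ) + 1 = y → x < τ x → ¬ y < τ y

lemma IsNonCrossing.eq_succ_of_even {τ : Fin L → Fin L} (h : IsNonCrossing τ) (hf : IsFlat τ) :
    ∀ x : Fin L, Even (x : ℕ) → (τ x : ℕ) = x + 1 := by
  intro x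
  induction x using WellFoundedLT.induction with
  | _ x ih =>
    intro hx
    -- Below `x` all sites are paired among themselves.
    have hbelow : ∀ z : Fin L, z < x → τ z < x := by
      intro z hz
      have hz' := Fin.lt_def.mp hz
      rcases Nat.even_or_odd (z : ℕ) with he | ho
      · have := ih z hz he
        rw [Fin.lt_def, this]
        rcases hx with ⟨i, hi⟩
        rcases he with ⟨j, hj⟩
        omega
      · obtain ⟨j, hj⟩ := ho
        have hzL := z.isLt
        have hw := ih ⟨2 * j, by omega⟩ (Fin.lt_def.mpr (by simp only; omega)) (even_two_mul j)
        have : τ ⟨2 * j, by omega⟩ = z := Fin.ext (by rw [hw, hj])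
        rw [← this, h.invol, Fin.lt_def]
        simp only
        omega
    have hxl : x < τ x := by
      refine lt_of_le_of_ne (not_lt.mp fun hlt => ?_) (h.ne x).symm
      have := hbelow _ hlt
      rw [h.invol] at this
      exact lt_irrefl _ this
    have hyL : (x : ℕ) + 1 < L := lt_of_le_of_lt (Fin.lt_def.mp hxl) (τ x).isLt
    set y : Fin L := ⟨x + 1, hyL⟩ with hy
    have hyr : τ y < y := lt_of_le_of_ne (not_lt.mp (hf x y rfl hxl)) (h.ne y)
    rcases lt_trichotomy (τ y) x with h1 | h1 | h1
    · have := hbelow _ h1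
      rw [h.invol, Fin.lt_def] at this
      simp only [hy] at this
      omega
    · rw [← h1, h.invol, h1]
    · rw [Fin.lt_def] at h1 hyr
      simp only [hy] at h1 hyr
      omega

lemma IsNonCrossing.eq_of_isFlat {τ τ' : Fin L → Fin L} (h : IsNonCrossing τ) (hf : IsFlat τ)
    (h' : IsNonCrossing τ') (hf' : IsFlat τ') : τ = τ' := by
  refine h.eq_of_left_iff h' fun x => ?_
  rcases Nat.even_or_odd (x : ℕ) with he | ⟨j, hj⟩
  · rw [Fin.lt_def, Fin.lt_def, h.eq_succ_of_even hf x he, h'.eq_succ_of_even hf' x he]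
  · have hxL := x.isLt
    have hz : ∀ τ : Fin L → Fin L, IsNonCrossing τ → IsFlat τ → ¬ x < τ x := by
      intro τ h hf
      have hw := h.eq_succ_of_even hf ⟨2 * j, by omega⟩ (even_two_mul j)
      have : τ ⟨2 * j, by omega⟩ = x := Fin.ext (by rw [hw, hj])
      rw [← this, h.invol, Fin.lt_def, this]
      simp only
      omega
    exact iff_of_false (hz τ h hf) (hz τ' h' hf')

lemma finRotate_eq {x y : Fin L} (hxy : (x : ℕ) + 1 = y) : finRotate L x = y := by
  obtain _ | n := L
  · exact x.elim0
  · have hne : x ≠ Fin.last n := by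
      intro hx; have := y.isLt; rw [hx, Fin.val_last] at hxy; omega
    exact Fin.ext (by rw [coe_finRotate_of_ne_last hne, hxy])

/-- Reconnecting two neighbouring left ends `x` and `y` replaces the left end `y` by the right
end of the arc at `y`. -/
lemma Matching.leftSet_reconnect (hL : Even L) (m : Matching L) {x y : Fin L}
    (hxy : (x : ℕ) + 1 = y) (hx : x < m.partner hL x) (hy : y < m.partner hL y) :
    (m.reconnect hL x).leftSet = insert (m.partner hL y) (m.leftSet.erase y) := by
  have h := m.isNonCrossing_partner hL
  ext z
  rw [← lt_partner_iff_mem hL, partner_reconnect, Finset.mem_insert, Finset.mem_erase,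
    ← lt_partner_iff_mem hL, finRotate_eq hxy]
  set τ := m.partner hL
  have hlt : x < y := Fin.lt_def.mpr (by omega)
  have hyx : y < τ x := by
    refine lt_of_le_of_ne (Fin.le_def.mpr (by have := Fin.lt_def.mp hx; omega)) fun h' => ?_
    rw [h', h.invol] at hy
    exact hx.not_gt hy
  have hnest := (h.nest x y hlt hyx).2
  have hi := h.invol
  have hxy' : x ≠ y := hlt.ne
  have h1 : τ x ≠ x := h.ne x
  have h2 : τ y ≠ y := h.ne y
  have h3 : τ y ≠ x := (hlt.trans hy).ne'
  by_cases z1 : z = x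
  · subst z1
    simp [SpinRing.reconnect, hlt, hx, hxy']
  by_cases z2 : z = y
  · subst z2
    simp [SpinRing.reconnect, z1, hlt.not_gt, h2.symm]
  by_cases z3 : z = τ x
  · subst z3
    simp [SpinRing.reconnect, z1, z2, hnest.not_gt, hnest.ne', hi, hx.not_gt]
  by_cases z4 : z = τ y
  · subst z4
    simp [SpinRing.reconnect, z1, z2, z3, hnest]
  simp [SpinRing.reconnect, z1, z2, z3, z4]

lemma Matching.weight_lt_weight_reconnect (hL : Even L) (m : Matching L) {x y : Fin L}
    (hxy : (x : ℕ) + 1 = y) (hx : x < m.partner hL x) (hy : y < m.partner hL y) :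
    weight m.leftSet < weight (m.reconnect hL x).leftSet := by
  have h := m.isNonCrossing_partner hL
  have hym : y ∈ m.leftSet := (m.lt_partner_iff_mem hL y).1 hy
  have hpm : m.partner hL y ∉ m.leftSet := by
    rw [← lt_partner_iff_mem hL, h.invol]
    exact hy.not_gt
  rw [leftSet_reconnect hL m hxy hx hy, weight, weight,
    Finset.sum_insert (fun h' => hpm (Finset.mem_of_mem_erase h')),
    ← Finset.add_sum_erase _ _ hym]
  exact Nat.add_lt_add_right (Fin.lt_def.mp hy) _

/-- The Temperley–Lieb relation `e_y e_x e_y = e_y`, applied to a matching with an arc `(y, w)`. -/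
lemma reconnect_reconnect {τ : Fin L → Fin L} (h : IsNonCrossing τ) {x y w : Fin L}
    (hxy : x ≠ y) (hxw : x ≠ w) (hyw : τ y = w) :
    reconnect (reconnect τ x y) y w = τ := by
  have hi := h.invol
  have hn := h.ne
  funext z
  simp only [reconnect]
  grind

/-- Every matching is reached from every other one by reconnections: raising the weight leads to
the flat matching, and each of these steps can be undone for a suitable choice of the sites. -/
lemma eq_univ_of_reconnect_mem (hL : Even L) (S : Set (Matching L)) (hS : S.Nonempty)
    (hcl : ∀ m ∈ S, ∀ x, m.partner hL x ≠ finRotate L x → m.reconnect hL x ∈ S) :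
    S = Set.univ := by
  have hne : ∀ (m : Matching L) {x y : Fin L}, (x : ℕ) + 1 = y → x < m.partner hL x →
      y < m.partner hL y → m.partner hL x ≠ finRotate L x := by
    intro m x y hxy hx hy h'
    rw [finRotate_eq hxy] at h'
    rw [← h', (m.isNonCrossing_partner hL).invol, h'] at hy
    exact hy.not_gt (Fin.lt_def.mpr (by omega))
  obtain ⟨m₀, hm₀, hmax⟩ :=
    Set.exists_max_image S (fun m => weight m.leftSet) S.toFinite hS
  have hflat : IsFlat (m₀.partner hL) := by
    intro x y hxy hx hy
    exact (hmax _ (hcl m₀ hm₀ x (hne m₀ hxy hx hy))).not_gt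
      (m₀.weight_lt_weight_reconnect hL hxy hx hy)
  refine Set.eq_univ_of_forall fun m => ?_
  obtain ⟨B, hB⟩ : ∃ B, ∀ m : Matching L, weight m.leftSet ≤ B := by
    obtain ⟨m₁, -, h⟩ := Set.exists_max_image Set.univ
      (fun m : Matching L => weight m.leftSet) Set.finite_univ ⟨m, trivial⟩
    exact ⟨_, fun m => h m trivial⟩
  induction hd : B - weight m.leftSet using Nat.strong_induction_on generalizing m with
  | _ d ih =>
  subst hd
  have h := m.isNonCrossing_partner hL
  by_cases hf : IsFlat (m.partner hL)
  · rwa [Matching.partner_injective hL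
      (h.eq_of_isFlat hf (m₀.isNonCrossing_partner hL) hflat)]
  -- Take the last pair of neighbouring left ends; its second site starts an arc of length one.
  obtain ⟨x, hx, hlast⟩ : ∃ x : Fin L, (∃ y : Fin L, (x : ℕ) + 1 = y ∧ x < m.partner hL x ∧
      y < m.partner hL y) ∧ ∀ x' : Fin L, (∃ y : Fin L, (x' : ℕ) + 1 = y ∧
      x' < m.partner hL x' ∧ y < m.partner hL y) → x' ≤ x := by
    simp only [IsFlat] at hf
    push Not at hf
    obtain ⟨x₁, y₁, h1, h2, h3⟩ := hf
    obtain ⟨x, hx, hmx⟩ := Set.exists_max_image {x : Fin L | ∃ y : Fin L, (x : ℕ) + 1 = y ∧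
      x < m.partner hL x ∧ y < m.partner hL y} id (Set.toFinite _) ⟨x₁, y₁, h1, h2, h3⟩
    exact ⟨x, hx, fun x' hx' => hmx x' hx'⟩
  obtain ⟨y, hxy, hxl, hyl⟩ := hx
  have hwL : (y : ℕ) + 1 < L := lt_of_le_of_lt (Fin.lt_def.mp hyl) (m.partner hL y).isLt
  have hwr : ¬ (⟨y + 1, hwL⟩ : Fin L) < m.partner hL ⟨y + 1, hwL⟩ := by
    intro hw
    have := hlast y ⟨_, rfl, hyl, hw⟩
    rw [Fin.le_def] at this
    omega
  have hyw : m.partner hL y = ⟨y + 1, hwL⟩ := by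
    by_contra hcon
    have h1 : (⟨y + 1, hwL⟩ : Fin L) < m.partner hL y :=
      lt_of_le_of_ne (Fin.lt_def.mp hyl) (Ne.symm hcon)
    have h2 := (h.nest y _ (Fin.lt_def.mpr (Nat.lt_succ_self _)) h1).1
    have h3 : m.partner hL ⟨y + 1, hwL⟩ < ⟨y + 1, hwL⟩ :=
      lt_of_le_of_ne (not_lt.mp hwr) (h.ne _)
    rw [Fin.lt_def] at h2 h3
    simp only at h2 h3
    omega
  have hwt := m.weight_lt_weight_reconnect hL hxy hxl hyl
  have hmem : m.reconnect hL x ∈ S :=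
    ih _ (by have := hB (m.reconnect hL x); omega) _ rfl
  have hxy' : x ≠ y := fun h' => by rw [h'] at hxy; omega
  have hback : (m.reconnect hL x).reconnect hL y = m := by
    apply Matching.partner_injective hL
    rw [Matching.partner_reconnect, Matching.partner_reconnect, finRotate_eq hxy,
      finRotate_eq (y := ⟨y + 1, hwL⟩) rfl]
    refine reconnect_reconnect h hxy' (fun h' => ?_) hyw
    rw [h'] at hxy
    simp only at hxy
    omega
  rw [← hback]
  refine hcl _ hmem y ?_
  rw [Matching.partner_reconnect, finRotate_eq hxy, finRotate_eq (y := ⟨y + 1, hwL⟩) rfl]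
  simp only [reconnect, hxy'.symm, if_true, if_false]
  intro h'
  rw [h'] at hxy
  simp only at hxy
  omega

lemma nonempty_matching (hL : Even L) : Nonempty (Matching L) := by
  obtain ⟨n, rfl⟩ := hL
  refine ⟨Matching.ofPartner (fun x : Fin (n + n) => if (x : ℕ) % 2 = 0
    then ⟨min (x + 1) (n + n - 1), by have := x.isLt; omega⟩
    else ⟨x - 1, by have := x.isLt; omega⟩) ⟨fun x => ?_, fun x => ?_, fun c p hcp hpc => ?_⟩⟩
  · have := x.isLt
    ext
    grind
  · have := x.isLt
    rw [ne_eq, Fin.ext_iff]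
    grind
  · have := c.isLt
    have := p.isLt
    rw [Fin.lt_def] at *
    grind

lemma act_hamiltonian_mem_sector (hL : Even L) {ψ : Space L} (hψ : ψ ∈ sector L 0) :
    act (hamiltonian L) ψ ∈ sector L 0 := by
  have h := (bracketBasis hL).sum_repr ⟨ψ, hψ⟩
  have h' : ∑ m, (bracketBasis hL).repr ⟨ψ, hψ⟩ m • bracket m = ψ := by
    have h2 := congrArg Subtype.val h
    simpa only [Submodule.coe_sum, Submodule.coe_smul, coe_bracketBasis] using h2
  rw [← h', map_sum]
  refine Submodule.sum_mem _ fun m _ => ?_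
  rw [map_smul, act_hamiltonian_bracket hL]
  exact Submodule.smul_mem _ _ (Submodule.sum_mem _ fun m' _ =>
    Submodule.smul_mem _ _ (bracket_mem_sector hL m'))

/-- The Hamiltonian on the spin-zero sector. -/
noncomputable def sectorHamiltonian (hL : Even L) : sector L 0 →ₗ[ℂ] sector L 0 :=
  (act (hamiltonian L)).restrict fun _ => act_hamiltonian_mem_sector hL

@[simp] lemma coe_sectorHamiltonian (hL : Even L) (ψ : sector L 0) :
    (sectorHamiltonian hL ψ : Space L) = act (hamiltonian L) ψ := rfl

lemma isSymmetric_sectorHamiltonian (hL : Even L) :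
    LinearMap.IsSymmetric (𝕜 := ℂ) (E := sector L 0) (sectorHamiltonian hL) :=
  fun ψ φ => isSymmetric_hamiltonian (ψ : Space L) φ

lemma sectorHamiltonian_bracketBasis (hL : Even L) (m : Matching L) :
    sectorHamiltonian hL (bracketBasis hL m)
      = ∑ m', (coeff hL m' m : ℂ) • bracketBasis hL m' := by
  apply Subtype.ext
  rw [coe_sectorHamiltonian, coe_bracketBasis, act_hamiltonian_bracket hL]
  simp

end SpinRing

open SpinRing in
theorem lemma1 (L : ℕ) (hL : Even L) :
    IsLeast (SpinRing.rayleighValues L 0) (SpinRing.Emin L 0) ∧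
    ∃ b : Module.Basis (SpinRing.Matching L) ℂ (SpinRing.sector L 0),
      (∀ m, (b m : SpinRing.Space L) = SpinRing.bracket m) ∧
      ∃ Θ : SpinRing.sector L 0,
        (∀ m, ∃ r : ℝ, 0 < r ∧ b.repr Θ m = (r : ℂ)) ∧
        SpinRing.act (SpinRing.hamiltonian L) (Θ : SpinRing.Space L) =
          (SpinRing.Emin L 0 : ℂ) • (Θ : SpinRing.Space L) ∧
        {ψ : SpinRing.Space L | ψ ∈ SpinRing.sector L 0 ∧
            SpinRing.act (SpinRing.hamiltonian L) ψ = (SpinRing.Emin L 0 : ℂ) • ψ} =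
          (Submodule.span ℂ {(Θ : SpinRing.Space L)} : Set (SpinRing.Space L)) := by
  have := nonempty_matching hL
  obtain ⟨e, hlow, Θ, hΘ, heig, hpos, huniq⟩ :=
    exists_pos_ground_state (E := sector L 0) (bracketBasis hL) (H := sectorHamiltonian hL)
      (a := coeff hL) (isSymmetric_sectorHamiltonian hL)
      (sectorHamiltonian_bracketBasis hL) (fun _ _ => coeff_nonpos hL) fun S hS hcl =>
        eq_univ_of_reconnect_mem hL S hS fun m hm x hx => hcl m hm _ (coeff_reconnect_neg hL hx)
  have hact : act (hamiltonian L) Θ = (e : ℂ) • (Θ : Space L) := congrArg Subtype.val heig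
  have hEmin : IsLeast (rayleighValues L 0) e := by
    have hΘ' : (Θ : Space L) ≠ 0 := fun h => hΘ (Subtype.ext h)
    refine ⟨⟨Θ, Θ.2, hΘ', ?_⟩, ?_⟩
    · rw [hact, inner_smul_right, inner_self_eq_norm_sq_to_K,
        eq_div_iff (pow_ne_zero 2 (norm_ne_zero_iff.mpr hΘ')), Complex.re_ofReal_mul]
      congr 1
      norm_cast
    · rintro _ ⟨ψ, hψ, hψ0, rfl⟩
      rw [le_div_iff₀ (pow_pos (norm_pos_iff.mpr hψ0) 2)]
      exact hlow ⟨ψ, hψ⟩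
  have hE : Emin L 0 = e := hEmin.csInf_eq
  rw [hE]
  refine ⟨hEmin, bracketBasis hL, coe_bracketBasis hL, Θ, hpos, hact, ?_⟩
  ext ψ
  rw [SetLike.mem_coe, Submodule.mem_span_singleton]
  constructor
  · rintro ⟨hψ, hψe⟩
    obtain ⟨c, hc⟩ := huniq ⟨ψ, hψ⟩ (Subtype.ext hψe)
    exact ⟨c, congrArg Subtype.val hc⟩
  · rintro ⟨c, rfl⟩
    refine ⟨Submodule.smul_mem _ _ Θ.2, ?_⟩
    rw [map_smul, hact, smul_comm]
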